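/- **Conventions.** A locally C*-algebra is a complete Hausdorff complex topological $*$-algebra $A$ whose topology is determined by the set $S(A)$ of its continuous C*-seminorms. A Hilbert $A$-module $E$ is a right $A$-module (compatibly a complex vector space) with an $A$-valued inner product $\langle\cdot,\cdot\rangle$ that is $A$-linear in the second variable, hermitian, positive and definite, and that is complete for the seminorms $\bar p(x)=\sqrt{p(\langle x,x\rangle)}$, $p\in S(A)$; it is full if the linear span of $\{\langle x,y\rangle : x,y\in E\}$ is dense in $A$. $L_A(E,F)$ is the space of adjointable (automatically bounded) $A$-module maps $E\to F$, with the seminorms $\tilde p(T)=\inf\{c\ge 0:\bar p(Tx)\le c\,\bar p(x)\ \forall x\}$, $p\in S(A)$; $K_A(E,F)$ is the closed linear span in it of the operators $\theta_{y,x}(\xi)=y\langle x,\xi\rangle$, and $L_A(E)=L_A(E,E)$, $K_A(E)=K_A(E,E)$. Locally C*-algebras $A$, $B$ are strongly Morita equivalent if there is a full Hilbert $A$-module $E$ with $B\cong K_A(E)$ as locally C*-algebras ($*$-isomorphic and homeomorphic). Hilbert modules $V$ over $A$ and $W$ over $B$ are Morita equivalent, $V\sim_M W$, if $K_A(V)$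 and $K_B(W)$ are strongly Morita equivalent. A representation of a Hilbert $A$-module $V$ is a map $\Phi:V\to B(H,K)$, with $H,K$ Hilbert spaces, together with a continuous $*$-morphism $\varphi:A\to B(H)$ such that $\Phi(x)^*\Phi(y)=\varphi(\langle x,y\rangle)$ for all $x,y\in V$. It is non-degenerate if the linear spans of $\Phi(V)H$ and $\Phi(V)^*K$ are dense in $K$ and $H$. Two representations $\Phi_i:V\to B(H_i,K_i)$ are unitarily equivalent if there are unitaries $U_1:H_1\to H_2$ and $U_2:K_1\to K_2$ with $U_2\Phi_1(v)=\Phi_2(v)U_1$ for all $v\in V$. If $E$ is an $A$-module with inner product and $\varphi:A\to B(H)$ a $*$-morphism, then $E\otimes_\varphi H$ denotes the Hilbert space completion of the algebraic tensor product $E\otimes H$ for $\langle x\otimes h,y\otimes k\rangle=\langle h,\varphi(\langle x,y\rangle)k\rangle$. Given a representation $\Phi:V\to B(H,K)$ of $V$, a $*$-morphism $\Psi:B\to L_A(E)$ through which $B$ acts continuously, and a Hilbert $B$-module $W$, the induced representation ${}_E^W\Phi$ of $W$ acts from ${}_EH=E\otimes_\varphi H$ to $W\otimes_{\psi}({}_EH)$,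 where $\psi(b)(x\otimes h)=\Psi(b)x\otimes h$ is its associated representation of $B$ on ${}_EH$, by ${}_E^W\Phi(w)(x\otimes h)=w\otimes x\otimes h$. **Theorem.** Let $V$ and $W$ be full Hilbert modules over locally C*-algebras $A$ and $B$, respectively, with $V\sim_M W$. Let $E$ be a full Hilbert $A$-module and $\iota:B\to K_A(E)$ an isomorphism of locally C*-algebras. Let $\tilde E=K_A(E,A)$, regarded as a $B$-module with action $T\cdot b=T\,\iota(b)$, inner product $\langle T,S\rangle=\iota^{-1}(T^*S)$, and left action $\alpha(a)T=aT$ of $A$. Then every non-degenerate representation $\Phi$ of $V$ is unitarily equivalent to ${}_{\tilde E}^V({}_E^W\Phi)$, where the inner representation is induced via $E$ with the left action $\iota$ of $B$, and the outer one via $\tilde E$ with the left action $\alpha$ of $A$. -/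

import Mathlib

open scoped ComplexConjugate InnerProductSpace TensorProduct NNReal
open Filter Topology

namespace LocallyCStar

/-! ### Locally C*-algebras -/

/-- A continuous C*-seminorm on a topological `*`-algebra `A`, i.e. an element of `S(A)`. -/
structure CStarSeminorm (A : Type*) [NonUnitalRing A] [StarRing A] [Module ℂ A]
    [TopologicalSpace A] extends Seminorm ℂ A where
  mul_le' : ∀ a b : A, toFun (a * b) ≤ toFun a * toFun b
  star_mul_self' : ∀ a : A, toFun (star a * a) = toFun a * toFun a
  continuous' : Continuous toFun

noncomputable instance (A : Type*) [NonUnitalRing A] [StarRing A] [Module ℂ A]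
    [TopologicalSpace A] : CoeFun (CStarSeminorm A) (fun _ => A → ℝ) :=
  ⟨fun p => p.toSeminorm⟩

/-- A locally C*-algebra: a complete Hausdorff complex topological `*`-algebra whose topology is
determined by its continuous C*-seminorms. (Joint continuity of the multiplication and continuity
of the involution follow from the last axiom.) -/
class LocallyCStarAlgebra (A : Type*) extends NonUnitalRing A, StarRing A, Module ℂ A,
    IsScalarTower ℂ A A, SMulCommClass ℂ A A, StarModule ℂ A, UniformSpace A,
    IsUniformAddGroup A, CompleteSpace A, T2Space A where
  withSeminorms : WithSeminorms (fun p : CStarSeminorm A => p.toSeminorm)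

section Modules

/-- A right module `E` over a `*`-algebra `A`, compatible with the complex vector space structures,
with an `A`-valued form `ip` which is `A`-linear in the second variable and hermitian.  Both the
action and the form are recorded as (sesqui)bilinear maps. -/
class InnerModule (A E : Type*) [NonUnitalRing A] [StarRing A] [Module ℂ A]
    [AddCommGroup E] [Module ℂ E] where
  /-- the right action, `ract x a = x a` -/
  ract : E →ₗ[ℂ] A →ₗ[ℂ] E
  /-- the inner product, `ip x y = ⟨x, y⟩` -/
  ip : E →ₗ⋆[ℂ] E →ₗ[ℂ] A
  ract_mul : ∀ (x : E) (a b : A), ract x (a * b) = ract (ract x a) b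
  ip_ract : ∀ (x y : E) (a : A), ip x (ract y a) = ip x y * a
  star_ip : ∀ x y : E, star (ip x y) = ip y x

variable (A : Type*) [NonUnitalRing A] [StarRing A] [Module ℂ A]
  {E F G : Type*} [AddCommGroup E] [Module ℂ E] [InnerModule A E]
  [AddCommGroup F] [Module ℂ F] [InnerModule A F]
  [AddCommGroup G] [Module ℂ G] [InnerModule A G]

/-- The `A`-valued inner product `⟨x, y⟩`, conjugate linear in `x`. -/
def ip (x y : E) : A := InnerModule.ip x y

variable {A}

/-- The right action `x a`. -/
def ract (x : E) (a : A) : E := InnerModule.ract x a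

theorem ip_add_right (x y z : E) : ip A x (y + z) = ip A x y + ip A x z := by simp [ip]
theorem ip_add_left (x y z : E) : ip A (x + y) z = ip A x z + ip A y z := by simp [ip]
theorem ip_smul_right (c : ℂ) (x y : E) : ip A x (c • y) = c • ip A x y := by simp [ip]
theorem ip_smul_left (c : ℂ) (x y : E) : ip A (c • x) y = conj c • ip A x y := by simp [ip]
theorem ip_neg_right (x y : E) : ip A x (-y) = - ip A x y := by simp [ip]
theorem ip_neg_left (x y : E) : ip A (-x) y = - ip A x y := by simp [ip]
theorem ip_zero_right (x : E) : ip A x 0 = 0 := by simp [ip]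
theorem ip_zero_left (x : E) : ip A 0 x = 0 := by simp [ip]
theorem ip_sum_right {ι : Type*} (s : Finset ι) (x : E) (y : ι → E) :
    ip A x (∑ i ∈ s, y i) = ∑ i ∈ s, ip A x (y i) := by simp [ip]
theorem ip_sum_left {ι : Type*} (s : Finset ι) (x : E) (y : ι → E) :
    ip A (∑ i ∈ s, y i) x = ∑ i ∈ s, ip A (y i) x := by simp [ip]
theorem ip_ract (x y : E) (a : A) : ip A x (ract y a) = ip A x y * a :=
  InnerModule.ip_ract x y a
theorem star_ip (x y : E) : star (ip A x y) = ip A y x := InnerModule.star_ip x y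
theorem ract_ip (x y : E) (a : A) : ip A (ract x a) y = star a * ip A x y := by
  rw [← star_ip, ip_ract, star_mul, star_ip]
theorem ract_add (x : E) (a b : A) : ract x (a + b) = ract x a + ract x b := by simp [ract]
theorem ract_smul (c : ℂ) (x : E) (a : A) : ract x (c • a) = c • ract x a := by simp [ract]
theorem add_ract (x y : E) (a : A) : ract (x + y) a = ract x a + ract y a := by simp [ract]
theorem smul_ract (c : ℂ) (x : E) (a : A) : ract (c • x) a = c • ract x a := by simp [ract]
theorem neg_ract (x : E) (a : A) : ract (-x) a = -ract x a := by simp [ract]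
theorem zero_ract (a : A) : ract (0 : E) a = 0 := by simp [ract]
theorem ract_mul (x : E) (a b : A) : ract x (a * b) = ract (ract x a) b :=
  InnerModule.ract_mul x a b

/-- The seminorm `p̄(x) = √(p ⟨x, x⟩)` on `E` attached to a continuous C*-seminorm `p` on `A`. -/
noncomputable def modNorm [TopologicalSpace A] (p : CStarSeminorm A) (x : E) : ℝ :=
  √(p (ip A x x))

variable (A) in
/-- `E` is full: the linear span of the inner products is dense in `A`. -/
def IsFull (E : Type*) [AddCommGroup E] [Module ℂ E] [InnerModule A E]
    [TopologicalSpace A] : Prop :=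
  Dense (Submodule.span ℂ {a : A | ∃ x y : E, a = ip A x y} : Set A)

end Modules

/-- A Hilbert module over a locally C*-algebra `A`: the inner product is positive and definite
(positive elements of `A` are those of the form `a* a`) and `E` is complete with respect to the
seminorms `p̄`, `p ∈ S(A)`. -/
class HilbertModule (A E : Type*) [LocallyCStarAlgebra A] [AddCommGroup E] [Module ℂ E] extends
    InnerModule A E where
  ip_self_nonneg : ∀ x : E, ∃ a : A, LocallyCStar.ip A x x = star a * a
  ip_self_eq_zero : ∀ x : E, LocallyCStar.ip A x x = 0 → x = 0
  complete : ∀ l : Filter E, l.NeBot →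
    (∀ p : CStarSeminorm A,
      Tendsto (fun z : E × E => modNorm p (z.1 - z.2)) (l ×ˢ l) (𝓝 0)) →
    ∃ x : E, ∀ p : CStarSeminorm A, Tendsto (fun y => modNorm p (y - x)) l (𝓝 0)

/-- A (non-unital) `*`-algebra is a module with inner product `⟨a, b⟩ = a* b` over itself. -/
instance instInnerModuleSelf (A : Type*) [LocallyCStarAlgebra A] : InnerModule A A where
  ract := LinearMap.mul ℂ A
  ip := LinearMap.mk₂'ₛₗ (starRingEnd ℂ) (RingHom.id ℂ) (fun a b : A => star a * b)
    (by intros; simp [add_mul]) (by intros; simp [smul_mul_assoc])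
    (by intros; simp [mul_add]) (by intros; simp [mul_smul_comm])
  ract_mul a b c := by simp [mul_assoc]
  ip_ract a b c := by simp [mul_assoc]
  star_ip a b := by simp

section Adj

/-! ### Adjointable and compact module maps -/

/-- An adjointable `A`-module map `T : E → F` together with its adjoint `T* : F → E`.  For Hilbert
modules either of the two maps determines the other one, and every adjointable map is bounded, so
that this is the space `L_A(E, F)`. -/
structure Adj (A E F : Type*) [NonUnitalRing A] [StarRing A] [Module ℂ A]
    [AddCommGroup E] [Module ℂ E] [InnerModule A E]
    [AddCommGroup F] [Module ℂ F] [InnerModule A F] where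
  /-- the map `T` -/
  toLin : E →ₗ[ℂ] F
  /-- the adjoint `T*` -/
  adjLin : F →ₗ[ℂ] E
  toLin_ract' : ∀ (x : E) (a : A), toLin (ract x a) = ract (toLin x) a
  adjLin_ract' : ∀ (y : F) (a : A), adjLin (ract y a) = ract (adjLin y) a
  ip_toLin' : ∀ (x : E) (y : F), ip A (toLin x) y = ip A x (adjLin y)

namespace Adj

variable {A : Type*} [NonUnitalRing A] [StarRing A] [Module ℂ A]
  {E F G : Type*} [AddCommGroup E] [Module ℂ E] [InnerModule A E]
  [AddCommGroup F] [Module ℂ F] [InnerModule A F]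
  [AddCommGroup G] [Module ℂ G] [InnerModule A G]

instance : CoeFun (Adj A E F) (fun _ => E → F) := ⟨fun T => T.toLin⟩

@[ext] theorem ext {S T : Adj A E F} (h : ∀ x, S x = T x) (h' : ∀ y, S.adjLin y = T.adjLin y) :
    S = T := by
  cases S; cases T
  congr
  · exact LinearMap.ext h
  · exact LinearMap.ext h'

theorem toLin_ract (T : Adj A E F) (x : E) (a : A) : T (ract x a) = ract (T x) a :=
  T.toLin_ract' x a
theorem adjLin_ract (T : Adj A E F) (y : F) (a : A) :
    T.adjLin (ract y a) = ract (T.adjLin y) a := T.adjLin_ract' y a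
theorem ip_toLin (T : Adj A E F) (x : E) (y : F) : ip A (T x) y = ip A x (T.adjLin y) :=
  T.ip_toLin' x y
theorem ip_adjLin (T : Adj A E F) (x : E) (y : F) : ip A (T.adjLin y) x = ip A y (T x) := by
  rw [← star_ip, ← ip_toLin, star_ip]

/-- The composite `S ∘ T`. -/
def comp (S : Adj A F G) (T : Adj A E F) : Adj A E G where
  toLin := S.toLin ∘ₗ T.toLin
  adjLin := T.adjLin ∘ₗ S.adjLin
  toLin_ract' x a := by simp [toLin_ract]
  adjLin_ract' x a := by simp [adjLin_ract]
  ip_toLin' x y := by simp [ip_toLin]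

/-- The adjoint `T*`. -/
def adjoint (T : Adj A E F) : Adj A F E where
  toLin := T.adjLin
  adjLin := T.toLin
  toLin_ract' := T.adjLin_ract'
  adjLin_ract' := T.toLin_ract'
  ip_toLin' x y := T.ip_adjLin y x

/-- The rank one operator `θ_{y, x} = y ⟨x, ·⟩`. -/
def theta (y : F) (x : E) : Adj A E F where
  toLin := (InnerModule.ract (A := A) y) ∘ₗ (InnerModule.ip x)
  adjLin := (InnerModule.ract (A := A) x) ∘ₗ (InnerModule.ip y)
  toLin_ract' z a := by
    change ract y (ip A x (ract z a)) = ract (ract y (ip A x z)) a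
    rw [ip_ract, ract_mul]
  adjLin_ract' z a := by
    change ract x (ip A y (ract z a)) = ract (ract x (ip A y z)) a
    rw [ip_ract, ract_mul]
  ip_toLin' z w := by
    change ip A (ract y (ip A x z)) w = ip A z (ract x (ip A y w))
    rw [ip_ract, ract_ip, star_ip]

@[simp] theorem comp_apply (S : Adj A F G) (T : Adj A E F) (x : E) : S.comp T x = S (T x) := rfl
@[simp] theorem comp_adjLin (S : Adj A F G) (T : Adj A E F) (x : G) :
    (S.comp T).adjLin x = T.adjLin (S.adjLin x) := rfl
@[simp] theorem adjoint_apply (T : Adj A E F) (x : F) : T.adjoint x = T.adjLin x := rfl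
@[simp] theorem adjoint_adjLin (T : Adj A E F) (x : E) : T.adjoint.adjLin x = T x := rfl
theorem theta_apply (y : F) (x z : E) : theta (A := A) y x z = ract y (ip A x z) := rfl
theorem theta_adjLin (y z : F) (x : E) :
    (theta (A := A) y x).adjLin z = ract x (ip A y z) := rfl

instance : Zero (Adj A E F) := ⟨⟨0, 0, by simp [zero_ract], by simp [zero_ract],
  by simp [ip_zero_left, ip_zero_right]⟩⟩
instance : Add (Adj A E F) := ⟨fun S T => ⟨S.toLin + T.toLin, S.adjLin + T.adjLin,
  by simp [toLin_ract, add_ract], by simp [adjLin_ract, add_ract],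
  by simp [ip_add_left, ip_add_right, ip_toLin]⟩⟩
instance : Neg (Adj A E F) := ⟨fun S => ⟨-S.toLin, -S.adjLin,
  by simp [toLin_ract, neg_ract], by simp [adjLin_ract, neg_ract],
  by simp [ip_neg_left, ip_neg_right, ip_toLin]⟩⟩
/-- Scalars act by `(c T) x = c (T x)`, so that `(c T)* = c̄ T*`. -/
instance : SMul ℂ (Adj A E F) := ⟨fun c S => ⟨c • S.toLin, conj c • S.adjLin,
  by simp [toLin_ract, smul_ract], by simp [adjLin_ract, smul_ract],
  by simp [ip_smul_left, ip_smul_right, ip_toLin]⟩⟩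

@[simp] theorem zero_apply (x : E) : (0 : Adj A E F) x = 0 := rfl
@[simp] theorem zero_adjLin (x : F) : (0 : Adj A E F).adjLin x = 0 := rfl
@[simp] theorem add_apply (S T : Adj A E F) (x : E) : (S + T) x = S x + T x := rfl
@[simp] theorem add_adjLin (S T : Adj A E F) (x : F) :
    (S + T).adjLin x = S.adjLin x + T.adjLin x := rfl
@[simp] theorem neg_apply (S : Adj A E F) (x : E) : (-S) x = - S x := rfl
@[simp] theorem neg_adjLin (S : Adj A E F) (x : F) : (-S).adjLin x = - S.adjLin x := rfl
@[simp] theorem smul_apply (c : ℂ) (S : Adj A E F) (x : E) : (c • S) x = c • S x := rfl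
@[simp] theorem smul_adjLin (c : ℂ) (S : Adj A E F) (x : F) :
    (c • S).adjLin x = conj c • S.adjLin x := rfl

instance : AddCommGroup (Adj A E F) where
  add_assoc S T U := by ext <;> simp [add_assoc]
  zero_add S := by ext <;> simp
  add_zero S := by ext <;> simp
  nsmul := nsmulRec
  zsmul := zsmulRec
  neg_add_cancel S := by ext <;> simp
  add_comm S T := by ext <;> simp [add_comm]

instance : Module ℂ (Adj A E F) where
  one_smul S := by ext <;> simp
  mul_smul c d S := by ext <;> simp [mul_smul]
  smul_zero c := by ext <;> simp
  smul_add c S T := by ext <;> simp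
  add_smul c d S := by ext <;> simp [add_smul]
  zero_smul S := by ext <;> simp

@[simp] theorem sub_apply (S T : Adj A E F) (x : E) : (S - T) x = S x - T x := by
  rw [sub_eq_add_neg, add_apply, neg_apply, sub_eq_add_neg]

/-- Composition makes the adjointable maps on `E` into a ring, with involution `T ↦ T*`. -/
instance : NonUnitalRing (Adj A E E) where
  mul := comp
  left_distrib S T U := by ext <;> simp [HMul.hMul]
  right_distrib S T U := by ext <;> simp [HMul.hMul]
  zero_mul S := by ext <;> simp [HMul.hMul]
  mul_zero S := by ext <;> simp [HMul.hMul]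
  mul_assoc S T U := by ext <;> simp [HMul.hMul]

@[simp] theorem mul_apply (S T : Adj A E E) (x : E) : (S * T) x = S (T x) := rfl
@[simp] theorem mul_adjLin (S T : Adj A E E) (x : E) :
    (S * T).adjLin x = T.adjLin (S.adjLin x) := rfl

instance : StarRing (Adj A E E) where
  star := adjoint
  star_involutive _ := rfl
  star_mul _ _ := rfl
  star_add _ _ := rfl

@[simp] theorem star_apply (S : Adj A E E) (x : E) : (star S) x = S.adjLin x := rfl
@[simp] theorem star_adjLin (S : Adj A E E) (x : E) : (star S).adjLin x = S x := rfl

variable [TopologicalSpace A]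

/-- `T.OpBound p c` says that `p̃(T) ≤ c`, where `p̃(T)` is the norm of the map that `T` induces
between the quotients of `E` and `F` by the kernels of `p̄`. -/
def OpBound (p : CStarSeminorm A) (T : Adj A E F) (c : ℝ) : Prop :=
  ∀ x : E, modNorm p (T x) ≤ c * modNorm p x

end Adj

/-- The linear span of the rank one operators `θ_{y, x} : E → F`. -/
def finiteRank (A E F : Type*) [NonUnitalRing A] [StarRing A] [Module ℂ A]
    [AddCommGroup E] [Module ℂ E] [InnerModule A E]
    [AddCommGroup F] [Module ℂ F] [InnerModule A F] : Submodule ℂ (Adj A E F) :=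
  Submodule.span ℂ {S : Adj A E F | ∃ y x, S = Adj.theta y x}

/-- `K_A(E, F)`: the closure, with respect to the (directed) family of seminorms `p̃`, `p ∈ S(A)`,
of the linear span of the rank one operators in the space `L_A(E, F)` of all adjointable maps. -/
def compacts (A E F : Type*) [NonUnitalRing A] [StarRing A] [Module ℂ A] [TopologicalSpace A]
    [AddCommGroup E] [Module ℂ E] [InnerModule A E]
    [AddCommGroup F] [Module ℂ F] [InnerModule A F] : Set (Adj A E F) :=
  {T | ∀ p : CStarSeminorm A, ∀ ε : ℝ, 0 < ε → ∃ S ∈ finiteRank A E F, (T - S).OpBound p ε}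

/-- A `*`-morphism `Ψ : A → L_B(E)` is continuous. -/
def IsContinuousAction {A B E : Type*} [LocallyCStarAlgebra A] [LocallyCStarAlgebra B]
    [AddCommGroup E] [Module ℂ E] [InnerModule B E] (Ψ : A →⋆ₙₐ[ℂ] Adj B E E) : Prop :=
  ∀ q : CStarSeminorm B, ∃ p : CStarSeminorm A, ∃ C : ℝ, ∀ a : A, (Ψ a).OpBound q (C * p a)

/-- `ι` is an isomorphism of locally C*-algebras from `B` onto `K_A(E)`: a bijective `*`-morphism
which is a homeomorphism for the topology of `K_A(E)` given by the seminorms `p̃`, `p ∈ S(A)`. -/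
structure IsCompactIso {A B E : Type*} [LocallyCStarAlgebra A] [LocallyCStarAlgebra B]
    [AddCommGroup E] [Module ℂ E] [InnerModule A E] (ι : B →⋆ₙₐ[ℂ] Adj A E E) : Prop where
  injective : Function.Injective ι
  range_eq : Set.range ι = compacts A E E
  continuous : IsContinuousAction ι
  continuous_inv : ∀ q : CStarSeminorm B, ∃ p : CStarSeminorm A, ∃ C : ℝ, ∀ (b : B) (c : ℝ),
    0 ≤ c → (ι b).OpBound p c → q b ≤ C * c

end Adj

universe u v w z

/-- Strong Morita equivalence of locally C*-algebras: there is a full Hilbert `A`-module `E` such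
that `B` and `K_A(E)` are isomorphic locally C*-algebras. -/
def StronglyMoritaEquivalent (A : Type u) (B : Type v) [LocallyCStarAlgebra A]
    [LocallyCStarAlgebra B] : Prop :=
  ∃ (E : Type (max u v)) (_ : AddCommGroup E) (_ : Module ℂ E) (_ : HilbertModule A E),
    IsFull A E ∧ ∃ ι : B →⋆ₙₐ[ℂ] Adj A E E, IsCompactIso ι

/-- Morita equivalence `V ∼_M W` of Hilbert modules: `K_A(V)` and `K_B(W)`, that is, locally
C*-algebras `C` and `D` isomorphic to them, are strongly Morita equivalent. -/
def MoritaEquivalent (A B : Type*) (V : Type u) (W : Type v) [LocallyCStarAlgebra A]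
    [LocallyCStarAlgebra B] [AddCommGroup V] [Module ℂ V] [HilbertModule A V]
    [AddCommGroup W] [Module ℂ W] [HilbertModule B W] : Prop :=
  ∃ (C : Type u) (D : Type v) (_ : LocallyCStarAlgebra C) (_ : LocallyCStarAlgebra D)
    (κ : C →⋆ₙₐ[ℂ] Adj A V V) (μ : D →⋆ₙₐ[ℂ] Adj B W W),
    IsCompactIso κ ∧ IsCompactIso μ ∧ StronglyMoritaEquivalent C D

/-! ### Representations -/

section Representations

variable {A B : Type*} [LocallyCStarAlgebra A] [LocallyCStarAlgebra B]
  {H : Type*} [NormedAddCommGroup H] [InnerProductSpace ℂ H] [CompleteSpace H]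
  {K : Type*} [NormedAddCommGroup K] [InnerProductSpace ℂ K] [CompleteSpace K]
  {H' : Type*} [NormedAddCommGroup H'] [InnerProductSpace ℂ H'] [CompleteSpace H']
  {K' : Type*} [NormedAddCommGroup K'] [InnerProductSpace ℂ K'] [CompleteSpace K']
  {E : Type*} [AddCommGroup E] [Module ℂ E]
  {V : Type*} [AddCommGroup V] [Module ℂ V]

/-- A representation of a Hilbert `A`-module `V` on the Hilbert spaces `H`, `K`: a map
`Φ : V → B(H, K)` together with a representation `φ` of `A` on `H`, i.e. a continuous `*`-morphism
`φ : A → B(H)`, such that `Φ(x)* Φ(y) = φ(⟨x, y⟩)` for all `x, y ∈ V`. -/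
structure ModuleRep (A V H K : Type*) [LocallyCStarAlgebra A] [AddCommGroup V] [Module ℂ V]
    [InnerModule A V] [NormedAddCommGroup H] [InnerProductSpace ℂ H] [CompleteSpace H]
    [NormedAddCommGroup K] [InnerProductSpace ℂ K] [CompleteSpace K] where
  /-- the associated representation `φ` of `A` -/
  base : A →⋆ₙₐ[ℂ] (H →L[ℂ] H)
  continuous_base : Continuous base
  /-- the map `Φ` -/
  toFun : V → (H →L[ℂ] K)
  adjoint_comp : ∀ x y : V,
    (ContinuousLinearMap.adjoint (toFun x)).comp (toFun y) = base (ip A x y)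

/-- Non-degeneracy: `Φ(V)H` is total in `K` and `Φ(V)*K` is total in `H`. -/
def ModuleRep.Nondegenerate [InnerModule A V] (Φ : ModuleRep A V H K) : Prop :=
  Dense (Submodule.span ℂ {k : K | ∃ v h, k = Φ.toFun v h} : Set K) ∧
  Dense (Submodule.span ℂ {h : H | ∃ v k, h = ContinuousLinearMap.adjoint (Φ.toFun v) k} : Set H)

/-- Unitary equivalence of representations of `V`. -/
def ModuleRep.UnitarilyEquivalent [InnerModule A V] (Φ : ModuleRep A V H K)
    (Φ' : ModuleRep A V H' K') : Prop :=
  ∃ (U₁ : H ≃ₗᵢ[ℂ] H') (U₂ : K ≃ₗᵢ[ℂ] K'), ∀ (v : V) (h : H),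
    U₂ (Φ.toFun v h) = Φ'.toFun v (U₁ h)

/-! ### The Hilbert space `E ⊗_φ H` -/

/-- The form `⟨h, φ(⟨x, x⟩) h⟩` is positive.  For Hilbert modules this always holds. -/
def PositiveOn (E : Type*) [AddCommGroup E] [Module ℂ E] [InnerModule A E]
    (φ : A →⋆ₙₐ[ℂ] (H →L[ℂ] H)) : Prop :=
  ∀ (x : E) (h : H), 0 ≤ RCLike.re ⟪h, φ (ip A x x) h⟫_ℂ

theorem HilbertModule.positiveOn (E : Type*) [AddCommGroup E] [Module ℂ E] [HilbertModule A E]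
    (φ : A →⋆ₙₐ[ℂ] (H →L[ℂ] H)) : PositiveOn E φ := by
  intro x h
  obtain ⟨a, ha⟩ := HilbertModule.ip_self_nonneg (A := A) x
  rw [ha, map_mul, map_star, ContinuousLinearMap.star_eq_adjoint, mul_apply_eq_comp,
    ContinuousLinearMap.adjoint_inner_right]
  exact inner_self_nonneg

variable [InnerModule A E]

theorem inner_apply_star (φ : A →⋆ₙₐ[ℂ] (H →L[ℂ] H)) (a : A) (h k : H) :
    ⟪h, φ (star a) k⟫_ℂ = ⟪φ a h, k⟫_ℂ := by
  rw [map_star, ContinuousLinearMap.star_eq_adjoint, ContinuousLinearMap.adjoint_inner_right]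

/-- The closed cyclic subspace generated by `h`. -/
noncomputable def cyc (φ : A →⋆ₙₐ[ℂ] (H →L[ℂ] H)) (h : H) : Submodule ℂ H :=
  (LinearMap.range ((ContinuousLinearMap.apply ℂ H h).toLinearMap ∘ₗ
    (φ : A →ₗ[ℂ] (H →L[ℂ] H)))).topologicalClosure

theorem apply_mem_cyc (φ : A →⋆ₙₐ[ℂ] (H →L[ℂ] H)) (h : H) (a : A) : φ a h ∈ cyc φ h :=
  Submodule.le_topologicalClosure _ ⟨a, rfl⟩

theorem cyc_closure (φ : A →⋆ₙₐ[ℂ] (H →L[ℂ] H)) (h : H) {k : H} (hk : k ∈ cyc φ h) :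
    k ∈ closure (Set.range fun a : A => φ a h) := hk

theorem cyc_invariant (φ : A →⋆ₙₐ[ℂ] (H →L[ℂ] H)) (h : H) (a : A) {k : H} (hk : k ∈ cyc φ h) :
    φ a k ∈ cyc φ h := by
  have := map_mem_closure (φ a).continuous (cyc_closure φ h hk)
    (t := Set.range fun a : A => φ a h) (by
      rintro _ ⟨b, rfl⟩
      exact ⟨a * b, by simp⟩)
  exact this

/-- The Gram form of a positive module is positive: `∑ ⟨hᵢ, φ(⟨xᵢ, xⱼ⟩) hⱼ⟩ ≥ 0`. -/
theorem gram_nonneg (φ : A →⋆ₙₐ[ℂ] (H →L[ℂ] H)) (hpos : PositiveOn E φ) {ι : Type*}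
    (s : Finset ι) (x : ι → E) (h : ι → H) :
    0 ≤ RCLike.re (∑ i ∈ s, ∑ j ∈ s, ⟪h i, φ (ip A (x i) (x j)) (h j)⟫_ℂ) := by
  classical
  induction s using Finset.induction_on generalizing h with
  | empty => simp
  | insert i₀ s hi₀ ih =>
    set M := cyc φ (h i₀) with hM
    have : CompleteSpace M :=
      (Submodule.isClosed_topologicalClosure _).completeSpace_coe
    -- split `h i = m i + n i` along `M`
    set m : ι → H := fun i => M.starProjection (h i) with hm
    set n : ι → H := fun i => h i - m i with hn
    have hmM : ∀ i, m i ∈ M := fun i => Submodule.starProjection_apply_mem M (h i)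
    have hnM : ∀ i, n i ∈ Mᗮ := fun i => Submodule.sub_starProjection_mem_orthogonal (h i)
    have hperp : ∀ a : A, ∀ k ∈ Mᗮ, φ a k ∈ Mᗮ := by
      intro a k hk
      rw [Submodule.mem_orthogonal]
      intro u hu
      rw [← star_star a, inner_apply_star]
      exact Submodule.inner_right_of_mem_orthogonal (cyc_invariant φ _ _ hu) hk
    have hn0 : ∀ a : A, φ a (n i₀) = 0 := by
      intro a
      have h1 : φ a (n i₀) ∈ M := by
        rw [hn]
        simp only [map_sub]
        exact M.sub_mem (apply_mem_cyc φ _ a) (cyc_invariant φ _ _ (hmM i₀))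
      have h2 := hperp a _ (hnM i₀)
      have := Submodule.inner_right_of_mem_orthogonal h1 h2
      exact inner_self_eq_zero.mp this
    have hsplit : ∀ i j (a : A), ⟪h i, φ a (h j)⟫_ℂ = ⟪m i, φ a (m j)⟫_ℂ + ⟪n i, φ a (n j)⟫_ℂ := by
      intro i j a
      have e : ∀ i, h i = m i + n i := fun i => by simp [hn]
      rw [e i, e j, map_add, inner_add_left, inner_add_right, inner_add_right,
        Submodule.inner_right_of_mem_orthogonal (hmM i) (hperp a _ (hnM j)),
        Submodule.inner_left_of_mem_orthogonal (cyc_invariant φ _ a (hmM j)) (hnM i)]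
      simp
    simp only [hsplit, Finset.sum_add_distrib, map_add]
    refine add_nonneg ?_ ?_
    · -- the cyclic part
      have key : ∀ k : ι → H, k ∈ Set.pi Set.univ (fun _ => closure (Set.range fun a : A => φ a (h i₀))) →
          0 ≤ RCLike.re (∑ i ∈ insert i₀ s, ∑ j ∈ insert i₀ s,
            ⟪k i, φ (ip A (x i) (x j)) (k j)⟫_ℂ) := by
        intro k hk
        rw [← closure_pi_set] at hk
        refine closure_minimal (s := Set.pi Set.univ fun _ => Set.range fun a : A => φ a (h i₀))
          (t := {k : ι → H | 0 ≤ RCLike.re (∑ i ∈ insert i₀ s, ∑ j ∈ insert i₀ s,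
            ⟪k i, φ (ip A (x i) (x j)) (k j)⟫_ℂ)}) ?_ ?_ hk
        · intro k hk
          simp only [Set.mem_pi, Set.mem_univ, true_implies, Set.mem_range] at hk
          choose a ha using hk
          have : (∑ i ∈ insert i₀ s, ∑ j ∈ insert i₀ s, ⟪k i, φ (ip A (x i) (x j)) (k j)⟫_ℂ) =
              ⟪h i₀, φ (ip A (∑ i ∈ insert i₀ s, ract (x i) (a i))
                (∑ i ∈ insert i₀ s, ract (x i) (a i))) (h i₀)⟫_ℂ := by
            simp only [ip_sum_left, ip_sum_right, map_sum, sum_apply, inner_sum]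
            rw [Finset.sum_comm]
            refine Finset.sum_congr rfl fun i _ => Finset.sum_congr rfl fun j _ => ?_
            rw [ip_ract, ract_ip, map_mul, map_mul, mul_apply_eq_comp,
              mul_apply_eq_comp, inner_apply_star, ha, ha]
          rw [Set.mem_ofPred_eq, this]
          exact hpos _ _
        · exact isClosed_le continuous_const (by fun_prop)
      exact key m fun i _ => cyc_closure φ _ (hmM i)
    · rw [Finset.sum_insert hi₀]
      have z1 : ∀ j, ⟪n i₀, φ (ip A (x i₀) (x j)) (n j)⟫_ℂ = 0 := by
        intro j
        rw [← star_star (ip A (x i₀) (x j)), inner_apply_star, hn0, inner_zero_left]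
      simp only [Finset.sum_insert hi₀, z1, hn0, inner_zero_right, zero_add,
        Finset.sum_const_zero]
      exact ih n

/-- The sesquilinear form `⟨x ⊗ h, y ⊗ k⟩ = ⟨h, φ(⟨x, y⟩) k⟩` on `E ⊗ H`. -/
noncomputable def tensorForm (E : Type*) [AddCommGroup E] [Module ℂ E] [InnerModule A E]
    (φ : A →⋆ₙₐ[ℂ] (H →L[ℂ] H)) :
    (E ⊗[ℂ] H) →ₗ⋆[ℂ] (E ⊗[ℂ] H) →ₗ[ℂ] ℂ :=
  TensorProduct.lift (LinearMap.mk₂'ₛₗ (starRingEnd ℂ) (starRingEnd ℂ)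
    (fun (x : E) (h : H) => TensorProduct.lift (LinearMap.mk₂ ℂ
      (fun (y : E) (k : H) => ⟪h, φ (ip A x y) k⟫_ℂ)
      (by intros; simp [ip_add_right])
      (by intros; simp [ip_smul_right])
      (by intros; simp)
      (by intros; simp)))
    (by intros; ext; simp [ip_add_left])
    (by intros; ext; simp [ip_smul_left])
    (by intros; ext; simp)
    (by intros; ext; simp [mul_comm]))

theorem tensorForm_tmul (φ : A →⋆ₙₐ[ℂ] (H →L[ℂ] H)) (x y : E) (h k : H) :
    tensorForm E φ (x ⊗ₜ h) (y ⊗ₜ k) = ⟪h, φ (ip A x y) k⟫_ℂ := rfl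

theorem tensorForm_conj (φ : A →⋆ₙₐ[ℂ] (H →L[ℂ] H)) (s t : E ⊗[ℂ] H) :
    conj (tensorForm E φ t s) = tensorForm E φ s t := by
  induction s with
  | zero => simp
  | add s₁ s₂ h₁ h₂ => simp [h₁, h₂]
  | tmul x h =>
    induction t with
    | zero => simp
    | add t₁ t₂ h₁ h₂ => simp [h₁, h₂]
    | tmul y k =>
      rw [tensorForm_tmul, tensorForm_tmul, inner_conj_symm, ← inner_apply_star, star_ip]

theorem tensorForm_nonneg (φ : A →⋆ₙₐ[ℂ] (H →L[ℂ] H)) (hpos : PositiveOn E φ) (t : E ⊗[ℂ] H) :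
    0 ≤ RCLike.re (tensorForm E φ t t) := by
  obtain ⟨S, rfl⟩ := TensorProduct.exists_finset t
  simp only [map_sum, LinearMap.sum_apply, tensorForm_tmul]
  have := gram_nonneg φ hpos S Prod.fst Prod.snd
  rw [Finset.sum_comm] at this
  simpa using this

set_option linter.unusedVariables false in
/-- The algebraic tensor product `E ⊗ H` carrying the semi-inner product `tensorForm`. -/
@[nolint unusedArguments]
def PreInd (E : Type*) [AddCommGroup E] [Module ℂ E] [InnerModule A E]
    (φ : A →⋆ₙₐ[ℂ] (H →L[ℂ] H)) (hpos : PositiveOn E φ) : Type _ := E ⊗[ℂ] H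

variable {φ : A →⋆ₙₐ[ℂ] (H →L[ℂ] H)} {hpos : PositiveOn E φ}

instance : AddCommGroup (PreInd E φ hpos) := inferInstanceAs (AddCommGroup (E ⊗[ℂ] H))
instance : Module ℂ (PreInd E φ hpos) := inferInstanceAs (Module ℂ (E ⊗[ℂ] H))

/-- The semi-inner product of `PreInd`. -/
noncomputable abbrev preIndCore (E : Type*) [AddCommGroup E] [Module ℂ E] [InnerModule A E]
    (φ : A →⋆ₙₐ[ℂ] (H →L[ℂ] H)) (hpos : PositiveOn E φ) :
    PreInnerProductSpace.Core ℂ (PreInd E φ hpos) where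
  inner s t := tensorForm E φ s t
  conj_inner_symm s t := tensorForm_conj φ s t
  re_inner_nonneg t := tensorForm_nonneg φ hpos t
  add_left s t u := LinearMap.congr_fun (map_add (tensorForm E φ) s t) u
  smul_left s t c := LinearMap.congr_fun (LinearMap.map_smulₛₗ (tensorForm E φ) c s) t

noncomputable instance : SeminormedAddCommGroup (PreInd E φ hpos) :=
  InnerProductSpace.Core.toSeminormedAddCommGroup (c := preIndCore E φ hpos)
noncomputable instance : InnerProductSpace ℂ (PreInd E φ hpos) :=
  InnerProductSpace.ofCore (preIndCore E φ hpos)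

/-- The Hilbert space `E ⊗_φ H`: the (Hausdorff) completion of `E ⊗ H` with respect to the
semi-inner product `⟨x ⊗ h, y ⊗ k⟩ = ⟨h, φ(⟨x, y⟩) k⟩`. -/
abbrev Ind (E : Type*) [AddCommGroup E] [Module ℂ E] [InnerModule A E]
    (φ : A →⋆ₙₐ[ℂ] (H →L[ℂ] H)) (hpos : PositiveOn E φ) : Type _ :=
  UniformSpace.Completion (PreInd E φ hpos)

/-- The elementary tensor `x ⊗ h` in `PreInd`. -/
def ptmul (hpos : PositiveOn E φ) (x : E) (h : H) : PreInd E φ hpos := x ⊗ₜ[ℂ] h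

theorem inner_ptmul (x y : E) (h k : H) :
    ⟪ptmul hpos x h, ptmul hpos y k⟫_ℂ = ⟪h, φ (ip A x y) k⟫_ℂ := rfl

theorem norm_ptmul_sq (x : E) (h : H) :
    ‖ptmul hpos x h‖ ^ 2 = RCLike.re ⟪h, φ (ip A x x) h⟫_ℂ := by
  rw [← inner_ptmul (hpos := hpos), ← inner_self_eq_norm_sq (𝕜 := ℂ)]

theorem PreInd.induction {P : PreInd E φ hpos → Prop} (t : PreInd E φ hpos) (h0 : P 0)
    (htmul : ∀ x h, P (ptmul hpos x h)) (hadd : ∀ s t, P s → P t → P (s + t)) : P t :=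
  TensorProduct.induction_on (motive := P) t h0 htmul hadd

/-- The operator `h ↦ x ⊗ h`. -/
noncomputable def tmulL (hpos : PositiveOn E φ) (x : E) : H →L[ℂ] Ind E φ hpos :=
  UniformSpace.Completion.toComplL.comp
    (LinearMap.mkContinuous (TensorProduct.mk ℂ E H x : H →ₗ[ℂ] PreInd E φ hpos)
      (√‖φ (ip A x x)‖) (by
        intro h
        change ‖ptmul hpos x h‖ ≤ _
        rw [← Real.sqrt_sq (norm_nonneg (ptmul hpos x h)), ← Real.sqrt_sq (norm_nonneg h),
          ← Real.sqrt_mul (norm_nonneg _)]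
        apply Real.sqrt_le_sqrt
        rw [norm_ptmul_sq]
        refine (RCLike.re_le_norm _).trans ((norm_inner_le_norm _ _).trans ?_)
        have := (φ (ip A x x)).le_opNorm h
        nlinarith [norm_nonneg h]))

theorem tmulL_apply (x : E) (h : H) :
    tmulL hpos x h = (ptmul hpos x h : Ind E φ hpos) := rfl

/-! ### Left actions on `E ⊗_φ H` -/

/-- The operator `T ⊗ 1` on the algebraic tensor product. -/
noncomputable def preLeft (hpos : PositiveOn E φ) (T : Adj A E E) :
    PreInd E φ hpos →ₗ[ℂ] PreInd E φ hpos :=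
  (TensorProduct.map T.toLin (LinearMap.id : H →ₗ[ℂ] H) : E ⊗[ℂ] H →ₗ[ℂ] E ⊗[ℂ] H)

theorem preLeft_ptmul (T : Adj A E E) (x : E) (h : H) :
    preLeft hpos T (ptmul hpos x h) = ptmul hpos (T x) h := rfl

theorem ptmul_add_left (x y : E) (h : H) :
    ptmul hpos (x + y) h = ptmul hpos x h + ptmul hpos y h := TensorProduct.add_tmul x y h

theorem ptmul_smul_left (c : ℂ) (x : E) (h : H) :
    ptmul hpos (c • x) h = c • ptmul hpos x h := rfl

theorem preLeft_add (S T : Adj A E E) (t : PreInd E φ hpos) :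
    preLeft hpos (S + T) t = preLeft hpos S t + preLeft hpos T t := by
  induction t using PreInd.induction with
  | h0 => simp
  | hadd s t hs ht => simp only [map_add, hs, ht]; abel
  | htmul x h => simp [preLeft_ptmul, ptmul_add_left]

theorem preLeft_smul (c : ℂ) (T : Adj A E E) (t : PreInd E φ hpos) :
    preLeft hpos (c • T) t = c • preLeft hpos T t := by
  induction t using PreInd.induction with
  | h0 => simp
  | hadd s t hs ht => simp only [map_add, hs, ht, smul_add]
  | htmul x h => simp [preLeft_ptmul, ptmul_smul_left]

theorem preLeft_mul (S T : Adj A E E) (t : PreInd E φ hpos) :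
    preLeft hpos (S * T) t = preLeft hpos S (preLeft hpos T t) := by
  induction t using PreInd.induction with
  | h0 => simp
  | hadd s t hs ht => simp only [map_add, hs, ht]
  | htmul x h => simp [preLeft_ptmul]

theorem inner_preLeft (T : Adj A E E) (s t : PreInd E φ hpos) :
    ⟪s, preLeft hpos T t⟫_ℂ = ⟪preLeft hpos (star T) s, t⟫_ℂ := by
  induction s using PreInd.induction with
  | h0 => simp
  | hadd s₁ s₂ h₁ h₂ => simp only [map_add, inner_add_left, h₁, h₂]
  | htmul x h =>
    induction t using PreInd.induction with
    | h0 => simp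
    | hadd t₁ t₂ h₁ h₂ => simp only [map_add, inner_add_right, h₁, h₂]
    | htmul y k =>
      rw [preLeft_ptmul, preLeft_ptmul, inner_ptmul, inner_ptmul, Adj.star_apply, Adj.ip_adjLin]

end Representations

theorem le_of_iterated_squares {u : ℕ → ℝ} {M C r : ℝ} (hM : 0 ≤ M)
    (hr : 0 ≤ r) (h1 : ∀ n, u n ^ 2 ≤ M * u (n + 1)) (h2 : ∀ n, u n ≤ C * r ^ (2 ^ n)) :
    u 0 ≤ M * r := by
  rcases hM.eq_or_lt with rfl | hM
  · have := h1 0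
    nlinarith [sq_nonneg (u 0)]
  by_contra! hlt
  set v := u 0 / M with hv
  have hrv : r < v := by rw [hv, lt_div_iff₀ hM]; linarith
  have hv0 : 0 < v := lt_of_le_of_lt hr hrv
  have key : ∀ n, v ^ (2 ^ n) * M ≤ u n := by
    intro n
    induction n with
    | zero => rw [hv, pow_zero, pow_one, div_mul_cancel₀ _ hM.ne']
    | succ n ih =>
      have h3 := h1 n
      have h4 : (v ^ (2 ^ n) * M) ^ 2 ≤ M * u (n + 1) :=
        (pow_le_pow_left₀ (by positivity) ih 2).trans h3
      have h5 : M * (v ^ (2 ^ (n + 1)) * M) ≤ M * u (n + 1) := by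
        calc M * (v ^ (2 ^ (n + 1)) * M) = (v ^ (2 ^ n) * M) ^ 2 := by ring
          _ ≤ _ := h4
      exact le_of_mul_le_mul_left h5 hM
  have h6 : ∀ n : ℕ, M ≤ C * (r / v) ^ (2 ^ n) := by
    intro n
    rw [div_pow, ← mul_div_assoc, le_div_iff₀ (by positivity)]
    linarith [key n, h2 n]
  have h7 : Tendsto (fun n : ℕ => C * (r / v) ^ (2 ^ n)) atTop (𝓝 (C * 0)) :=
    ((tendsto_pow_atTop_nhds_zero_of_lt_one (by positivity) ((div_lt_one hv0).mpr hrv)).comp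
      (tendsto_pow_atTop_atTop_of_one_lt (by norm_num))).const_mul C
  have := ge_of_tendsto' h7 h6
  linarith

section Induction

variable {A B : Type*} [LocallyCStarAlgebra A] [LocallyCStarAlgebra B]
  {H : Type*} [NormedAddCommGroup H] [InnerProductSpace ℂ H] [CompleteSpace H]
  {K : Type*} [NormedAddCommGroup K] [InnerProductSpace ℂ K] [CompleteSpace K]
  {E : Type*} [AddCommGroup E] [Module ℂ E] [InnerModule A E]
  {φ : A →⋆ₙₐ[ℂ] (H →L[ℂ] H)} {hpos : PositiveOn E φ}

/-- The left action `Ψ` of `B` on `E` is continuous relative to `φ`: for all `x ∈ E`, `h ∈ H` the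
seminorm `b ↦ ‖Ψ(b) x ⊗ h‖` is bounded by a multiple of a fixed continuous C*-seminorm.  This
holds for every continuous `*`-morphism `Ψ : B → L_A(E)`. -/
def Dominated (φ : A →⋆ₙₐ[ℂ] (H →L[ℂ] H)) (Ψ : B →⋆ₙₐ[ℂ] Adj A E E) : Prop :=
  ∃ p : CStarSeminorm B, ∀ (x : E) (h : H), ∃ C : ℝ, ∀ b : B,
    RCLike.re ⟪h, φ (ip A (Ψ b x) (Ψ b x)) h⟫_ℂ ≤ (C * p b) ^ 2

theorem norm_preLeft_le (hpos : PositiveOn E φ) {Ψ : B →⋆ₙₐ[ℂ] Adj A E E}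
    (hΨ : Dominated φ Ψ) : ∃ p : CStarSeminorm B, ∀ (b : B) (t : PreInd E φ hpos),
      ‖preLeft hpos (Ψ b) t‖ ≤ p b * ‖t‖ := by
  obtain ⟨p, hp⟩ := hΨ
  refine ⟨p, ?_⟩
  have hbd : ∀ t : PreInd E φ hpos, ∃ C : ℝ, ∀ b, ‖preLeft hpos (Ψ b) t‖ ≤ C * p b := by
    intro t
    induction t using PreInd.induction with
    | h0 => exact ⟨0, by simp⟩
    | hadd s t hs ht =>
      obtain ⟨C, hC⟩ := hs
      obtain ⟨D, hD⟩ := ht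
      refine ⟨C + D, fun b => ?_⟩
      rw [map_add, add_mul]
      exact (norm_add_le _ _).trans (add_le_add (hC b) (hD b))
    | htmul x h =>
      obtain ⟨C, hC⟩ := hp x h
      refine ⟨|C|, fun b => ?_⟩
      rw [preLeft_ptmul]
      refine abs_le_of_sq_le_sq' ?_ (mul_nonneg (abs_nonneg _) (apply_nonneg _ _)) |>.2
      rw [norm_ptmul_sq]
      refine (hC b).trans_eq ?_
      rw [mul_pow, mul_pow, sq_abs]
  have hsq : ∀ (b : B) (t : PreInd E φ hpos),
      ‖preLeft hpos (Ψ b) t‖ ^ 2 ≤ ‖t‖ * ‖preLeft hpos (Ψ (star b * b)) t‖ := by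
    intro b t
    rw [← inner_self_eq_norm_sq (𝕜 := ℂ), inner_preLeft, ← map_star, ← preLeft_mul, ← map_mul,
      ← inner_conj_symm, RCLike.conj_re]
    exact (RCLike.re_le_norm _).trans (norm_inner_le_norm _ _)
  intro b t
  let c : ℕ → B := fun n => Nat.rec (star b * b) (fun _ x => x * x) n
  have hc1 : ∀ n, c (n + 1) = c n * c n := fun n => rfl
  have hc0 : c 0 = star b * b := rfl
  have hcs : ∀ n, star (c n) = c n := by
    intro n
    induction n with
    | zero => simp [hc0]
    | succ n ih => rw [hc1, star_mul, ih]
  have hcp : ∀ n, p (c n) ≤ (p b ^ 2) ^ (2 ^ n) := by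
    intro n
    induction n with
    | zero => rw [hc0, pow_zero, pow_one, sq]; exact (p.star_mul_self' b).le
    | succ n ih =>
      rw [hc1]
      refine (p.mul_le' _ _).trans ?_
      calc p (c n) * p (c n) ≤ (p b ^ 2) ^ (2 ^ n) * (p b ^ 2) ^ (2 ^ n) :=
            mul_le_mul ih ih (apply_nonneg _ _) (by positivity)
        _ = _ := by rw [← pow_add, pow_succ 2 n, mul_two]
  obtain ⟨C, hC⟩ := hbd t
  have hfin := le_of_iterated_squares (u := fun n => ‖preLeft hpos (Ψ (c n)) t‖) (M := ‖t‖)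
    (C := |C|) (r := p b ^ 2) (norm_nonneg _) (by positivity)
    (fun n => by
      have := hsq (c n) t
      rwa [hcs, ← hc1] at this)
    (fun n => (hC _).trans (mul_le_mul (le_abs_self C) (hcp n) (apply_nonneg _ _) (abs_nonneg _)))
  have h2 := hsq b t
  refine abs_le_of_sq_le_sq' ?_ (mul_nonneg (apply_nonneg _ _) (norm_nonneg _)) |>.2
  refine h2.trans ?_
  calc ‖t‖ * ‖preLeft hpos (Ψ (star b * b)) t‖ ≤ ‖t‖ * (‖t‖ * p b ^ 2) :=
        mul_le_mul_of_nonneg_left hfin (norm_nonneg _)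
    _ = _ := by ring

/-- The bounded operator `Ψ(b) ⊗ 1` on the algebraic tensor product. -/
noncomputable def preLeftL (hpos : PositiveOn E φ) {Ψ : B →⋆ₙₐ[ℂ] Adj A E E}
    (hΨ : Dominated φ Ψ) (b : B) : PreInd E φ hpos →L[ℂ] PreInd E φ hpos :=
  (preLeft hpos (Ψ b)).mkContinuous ((norm_preLeft_le hpos hΨ).choose b)
    ((norm_preLeft_le hpos hΨ).choose_spec b)

theorem preLeftL_apply {Ψ : B →⋆ₙₐ[ℂ] Adj A E E} (hΨ : Dominated φ Ψ) (b : B)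
    (t : PreInd E φ hpos) : preLeftL hpos hΨ b t = preLeft hpos (Ψ b) t := rfl

theorem ind_ext {S T : Ind E φ hpos →L[ℂ] Ind E φ hpos}
    (h : ∀ t : PreInd E φ hpos, S (t : Ind E φ hpos) = T (t : Ind E φ hpos)) : S = T :=
  ContinuousLinearMap.ext fun x => congrFun
    (UniformSpace.Completion.denseRange_coe.equalizer S.continuous T.continuous (funext h)) x

/-- The bounded operator `Ψ(b) ⊗ 1` on `E ⊗_φ H`. -/
noncomputable def leftOp (hpos : PositiveOn E φ) {Ψ : B →⋆ₙₐ[ℂ] Adj A E E}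
    (hΨ : Dominated φ Ψ) (b : B) : Ind E φ hpos →L[ℂ] Ind E φ hpos :=
  (preLeftL hpos hΨ b).completion

theorem leftOp_coe {Ψ : B →⋆ₙₐ[ℂ] Adj A E E} (hΨ : Dominated φ Ψ) (b : B)
    (t : PreInd E φ hpos) :
    leftOp hpos hΨ b (t : Ind E φ hpos) = (preLeft hpos (Ψ b) t : Ind E φ hpos) :=
  ContinuousLinearMap.completion_apply_coe _ _

theorem leftOp_add {Ψ : B →⋆ₙₐ[ℂ] Adj A E E} (hΨ : Dominated φ Ψ) (a b : B) :
    leftOp hpos hΨ (a + b) = leftOp hpos hΨ a + leftOp hpos hΨ b := by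
  refine ind_ext fun t => ?_
  rw [add_apply, leftOp_coe, leftOp_coe, leftOp_coe, map_add, preLeft_add,
    UniformSpace.Completion.coe_add]

theorem leftOp_smul {Ψ : B →⋆ₙₐ[ℂ] Adj A E E} (hΨ : Dominated φ Ψ) (c : ℂ) (b : B) :
    leftOp hpos hΨ (c • b) = c • leftOp hpos hΨ b := by
  refine ind_ext fun t => ?_
  rw [smul_apply, leftOp_coe, leftOp_coe, map_smul, preLeft_smul,
    UniformSpace.Completion.coe_smul]

theorem leftOp_mul {Ψ : B →⋆ₙₐ[ℂ] Adj A E E} (hΨ : Dominated φ Ψ) (a b : B) :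
    leftOp hpos hΨ (a * b) = leftOp hpos hΨ a * leftOp hpos hΨ b := by
  refine ind_ext fun t => ?_
  rw [mul_apply_eq_comp, leftOp_coe, leftOp_coe, leftOp_coe, map_mul, preLeft_mul]

theorem leftOp_star {Ψ : B →⋆ₙₐ[ℂ] Adj A E E} (hΨ : Dominated φ Ψ) (b : B) :
    leftOp hpos hΨ (star b) = star (leftOp hpos hΨ b) := by
  rw [ContinuousLinearMap.star_eq_adjoint]
  refine (ContinuousLinearMap.eq_adjoint_iff _ _).mpr fun s t => ?_
  induction s, t using UniformSpace.Completion.induction_on₂ with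
  | hp =>
    exact isClosed_eq (((leftOp hpos hΨ (star b)).continuous.comp continuous_fst).inner
      continuous_snd) (continuous_fst.inner ((leftOp hpos hΨ b).continuous.comp continuous_snd))
  | ih s t =>
    rw [leftOp_coe, leftOp_coe, UniformSpace.Completion.inner_coe,
      UniformSpace.Completion.inner_coe, inner_preLeft, map_star]

/-- The representation of `B` on `E ⊗_φ H` given by `b (x ⊗ h) = Ψ(b) x ⊗ h`. -/
noncomputable def leftRep (hpos : PositiveOn E φ) {Ψ : B →⋆ₙₐ[ℂ] Adj A E E}
    (hΨ : Dominated φ Ψ) : B →⋆ₙₐ[ℂ] (Ind E φ hpos →L[ℂ] Ind E φ hpos) where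
  toFun := leftOp hpos hΨ
  map_smul' := leftOp_smul hΨ
  map_zero' := by
    have := leftOp_smul (hpos := hpos) hΨ (0 : ℂ) 0
    rwa [zero_smul, zero_smul] at this
  map_add' := leftOp_add hΨ
  map_mul' := leftOp_mul hΨ
  map_star' := leftOp_star hΨ

theorem leftRep_ptmul (hpos : PositiveOn E φ) {Ψ : B →⋆ₙₐ[ℂ] Adj A E E} (hΨ : Dominated φ Ψ)
    (b : B) (x : E) (h : H) :
    leftRep hpos hΨ b (ptmul hpos x h : Ind E φ hpos) = (ptmul hpos (Ψ b x) h : Ind E φ hpos) :=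
  ContinuousLinearMap.completion_apply_coe _ _

theorem leftRep_coe (hpos : PositiveOn E φ) {Ψ : B →⋆ₙₐ[ℂ] Adj A E E} (hΨ : Dominated φ Ψ)
    (b : B) (t : PreInd E φ hpos) :
    leftRep hpos hΨ b (t : Ind E φ hpos) = (preLeft hpos (Ψ b) t : Ind E φ hpos) :=
  ContinuousLinearMap.completion_apply_coe _ _

open UniformSpace in
theorem continuous_leftRep (hpos : PositiveOn E φ) {Ψ : B →⋆ₙₐ[ℂ] Adj A E E}
    (hΨ : Dominated φ Ψ) : Continuous (leftRep hpos hΨ) := by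
  obtain ⟨p, hp⟩ := norm_preLeft_le hpos hΨ
  have hb : ∀ b, ‖leftRep hpos hΨ b‖ ≤ p b := by
    intro b
    refine ContinuousLinearMap.opNorm_le_bound _ (apply_nonneg _ _) fun t => ?_
    induction t using Completion.induction_on with
    | hp => exact isClosed_le (leftRep hpos hΨ b).continuous.norm (continuous_const.mul continuous_norm)
    | ih t => rw [leftRep_coe, Completion.norm_coe, Completion.norm_coe]; exact hp b t
  refine continuous_of_continuousAt_zero (leftRep hpos hΨ) ?_
  rw [ContinuousAt, map_zero, tendsto_zero_iff_norm_tendsto_zero]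
  have h0 : Tendsto (fun b => p b) (𝓝 0) (𝓝 0) := by
    have := p.continuous'.tendsto 0
    rwa [show p.toFun 0 = 0 from map_zero p.toSeminorm] at this
  exact squeeze_zero (fun _ => norm_nonneg _) hb h0

/-! ### Induced representations -/

/-- The representation `η_ψ` of a module `V` on `H`, `V ⊗_ψ H` obtained from a representation `ψ`
of `A` on `H`; it is given by `η_ψ(v) h = v ⊗ h`. -/
noncomputable def etaRep (V : Type*) [AddCommGroup V] [Module ℂ V] [HilbertModule A V]
    (ψ : A →⋆ₙₐ[ℂ] (H →L[ℂ] H)) (hψ : Continuous ψ) :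
    ModuleRep A V H (Ind V ψ (HilbertModule.positiveOn V ψ)) where
  base := ψ
  continuous_base := hψ
  toFun := tmulL (HilbertModule.positiveOn V ψ)
  adjoint_comp x y := by
    ext k
    refine ext_inner_left ℂ fun h => ?_
    rw [ContinuousLinearMap.comp_apply, ContinuousLinearMap.adjoint_inner_right, tmulL_apply,
      tmulL_apply, UniformSpace.Completion.inner_coe, inner_ptmul]

/-- The Rieffel induced representation from `V` to `W` via `E` (with the left action
`Ψ : B → L_A(E)`): it acts from `E ⊗_φ H` to `W ⊗ (E ⊗_φ H)` by `w ↦ (x ⊗ h ↦ w ⊗ x ⊗ h)`, and its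
associated representation of `B` is `b (x ⊗ h) = Ψ(b) x ⊗ h`. -/
noncomputable def ModuleRep.induce {V : Type*} [AddCommGroup V] [Module ℂ V] [InnerModule A V]
    (Φ : ModuleRep A V H K) (W : Type*) [AddCommGroup W] [Module ℂ W] [HilbertModule B W]
    (Ψ : B →⋆ₙₐ[ℂ] Adj A E E) (hpos : PositiveOn E Φ.base) (hΨ : Dominated Φ.base Ψ) :
    ModuleRep B W (Ind E Φ.base hpos)
      (Ind W (leftRep hpos hΨ) (HilbertModule.positiveOn W (leftRep hpos hΨ))) :=
  etaRep W (leftRep hpos hΨ) (continuous_leftRep hpos hΨ)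

/-- The continuous C*-seminorm `‖φ(·)‖` of a representation. -/
noncomputable def repSeminorm (φ : A →⋆ₙₐ[ℂ] (H →L[ℂ] H)) (hφ : Continuous φ) :
    CStarSeminorm A where
  toFun a := ‖φ a‖
  map_zero' := by simp
  add_le' a b := by rw [map_add]; exact norm_add_le _ _
  neg' a := by rw [map_neg, norm_neg]
  smul' c a := by rw [map_smul, norm_smul]
  mul_le' a b := by rw [map_mul]; exact norm_mul_le _ _
  star_mul_self' a := by rw [map_mul, map_star]; exact CStarRing.norm_star_mul_self
  continuous' := hφ.norm

theorem repSeminorm_apply (φ : A →⋆ₙₐ[ℂ] (H →L[ℂ] H)) (hφ : Continuous φ) (a : A) :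
    repSeminorm φ hφ a = ‖φ a‖ := rfl

theorem dominated_of_continuous {φ : A →⋆ₙₐ[ℂ] (H →L[ℂ] H)} (hφ : Continuous φ)
    {Ψ : B →⋆ₙₐ[ℂ] Adj A E E} (hΨ : IsContinuousAction Ψ) : Dominated φ Ψ := by
  obtain ⟨p, C, hp⟩ := hΨ (repSeminorm φ hφ)
  refine ⟨p, fun x h => ⟨‖h‖ * C * modNorm (repSeminorm φ hφ) x, fun b => ?_⟩⟩
  have h1 := hp b x
  have h2 : RCLike.re ⟪h, φ (ip A (Ψ b x) (Ψ b x)) h⟫_ℂ ≤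
      ‖h‖ ^ 2 * modNorm (repSeminorm φ hφ) (Ψ b x) ^ 2 := by
    rw [modNorm, Real.sq_sqrt (apply_nonneg _ _), repSeminorm_apply]
    refine (RCLike.re_le_norm _).trans ((norm_inner_le_norm _ _).trans ?_)
    have := (φ (ip A (Ψ b x) (Ψ b x))).le_opNorm h
    nlinarith [norm_nonneg h]
  refine h2.trans ?_
  have h3 := pow_le_pow_left₀ (Real.sqrt_nonneg _) h1 2
  calc _ ≤ ‖h‖ ^ 2 * (C * p b * modNorm (repSeminorm φ hφ) x) ^ 2 :=
        mul_le_mul_of_nonneg_left h3 (by positivity)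
    _ = _ := by ring

end Induction

/-! ### The dual module `Ẽ = K_A(E, A)` -/

section Tilde

variable {A B : Type*} [LocallyCStarAlgebra A] [LocallyCStarAlgebra B]
  {E : Type*} [AddCommGroup E] [Module ℂ E] [HilbertModule A E]

theorem ip_self_alg (a b : A) : ip A a b = star a * b := rfl
theorem ract_alg (a b : A) : ract a b = a * b := rfl

theorem modNorm_alg (p : CStarSeminorm A) (a : A) : modNorm p a = p a := by
  rw [modNorm, ip_self_alg]
  have : p (star a * a) = p a * p a := p.star_mul_self' a
  rw [this, Real.sqrt_mul_self (apply_nonneg _ _)]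

theorem modNorm_nonneg (p : CStarSeminorm A) (x : E) : 0 ≤ modNorm p x := Real.sqrt_nonneg _

theorem comp_finiteRank {F G : Type*} [AddCommGroup F] [Module ℂ F] [InnerModule A F]
    [AddCommGroup G] [Module ℂ G] [InnerModule A G] (S : Adj A F G) {R : Adj A E F}
    (hR : R ∈ finiteRank A E F) : S.comp R ∈ finiteRank A E G := by
  induction hR using Submodule.span_induction with
  | mem R h =>
    obtain ⟨y, x, rfl⟩ := h
    refine Submodule.subset_span ⟨S y, x, ?_⟩
    ext z
    · simp [Adj.theta_apply, Adj.toLin_ract]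
    · simp [Adj.theta_adjLin, Adj.ip_toLin]
  | zero =>
    have : S.comp (0 : Adj A E F) = 0 := by ext <;> simp
    rw [this]; exact zero_mem _
  | add R₁ R₂ _ _ h₁ h₂ =>
    have : S.comp (R₁ + R₂) = S.comp R₁ + S.comp R₂ := by ext <;> simp
    rw [this]; exact add_mem h₁ h₂
  | smul c R _ h =>
    have : S.comp (c • R) = c • S.comp R := by ext <;> simp
    rw [this]; exact Submodule.smul_mem _ _ h

theorem finiteRank_comp {F G : Type*} [AddCommGroup F] [Module ℂ F] [InnerModule A F]
    [AddCommGroup G] [Module ℂ G] [InnerModule A G] {R : Adj A F G} (S : Adj A E F)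
    (hR : R ∈ finiteRank A F G) : R.comp S ∈ finiteRank A E G := by
  induction hR using Submodule.span_induction with
  | mem R h =>
    obtain ⟨y, x, rfl⟩ := h
    refine Submodule.subset_span ⟨y, S.adjLin x, ?_⟩
    ext z
    · simp [Adj.theta_apply, Adj.ip_adjLin]
    · simp [Adj.theta_adjLin, Adj.adjLin_ract]
  | zero =>
    have : (0 : Adj A F G).comp S = 0 := by ext <;> simp
    rw [this]; exact zero_mem _
  | add R₁ R₂ _ _ h₁ h₂ =>
    have : (R₁ + R₂).comp S = R₁.comp S + R₂.comp S := by ext <;> simp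
    rw [this]; exact add_mem h₁ h₂
  | smul c R _ h =>
    have : (c • R).comp S = c • R.comp S := by ext <;> simp
    rw [this]; exact Submodule.smul_mem _ _ h

theorem comp_opBound {F G : Type*} [AddCommGroup F] [Module ℂ F] [InnerModule A F]
    [AddCommGroup G] [Module ℂ G] [InnerModule A G] {p : CStarSeminorm A} {S : Adj A F G}
    {T : Adj A E F} {c d : ℝ} (hc : 0 ≤ c) (hS : S.OpBound p c) (hT : T.OpBound p d) :
    (S.comp T).OpBound p (c * d) := fun x => by
  rw [Adj.comp_apply, mul_assoc]
  exact (hS _).trans (mul_le_mul_of_nonneg_left (hT x) hc)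

theorem adjoint_finiteRank {F : Type*} [AddCommGroup F] [Module ℂ F] [InnerModule A F]
    {R : Adj A E F} (hR : R ∈ finiteRank A E F) : R.adjoint ∈ finiteRank A F E := by
  induction hR using Submodule.span_induction with
  | mem R h =>
    obtain ⟨y, x, rfl⟩ := h
    exact Submodule.subset_span ⟨x, y, rfl⟩
  | zero => exact zero_mem _
  | add R₁ R₂ _ _ h₁ h₂ => exact add_mem h₁ h₂
  | smul c R _ h =>
    have : (c • R).adjoint = (conj c) • R.adjoint := by ext <;> simp
    rw [this]; exact Submodule.smul_mem _ _ h

theorem adjoint_opBound {p : CStarSeminorm A} {T : Adj A E A} {c : ℝ} (hc0 : 0 ≤ c)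
    (hc : T.OpBound p c) : T.adjoint.OpBound p c := by
  intro a
  rw [Adj.adjoint_apply, modNorm_alg]
  set n := modNorm p (T.adjLin a) with hn
  have h1 : n ^ 2 ≤ (c * p a) * n := by
    rw [hn]
    nth_rewrite 1 [modNorm]
    rw [Real.sq_sqrt (apply_nonneg _ _), Adj.ip_adjLin, ip_self_alg]
    refine (p.mul_le' _ _).trans ?_
    have h2 : p (T (T.adjLin a)) ≤ c * n := by
      have := hc (T.adjLin a)
      rwa [modNorm_alg] at this
    have h3 : p (star a) ≤ p a := by
      have e : p (star (star a) * star a) = p (star a) * p (star a) := p.star_mul_self' (star a)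
      have f : p (star (star a) * star a) ≤ p a * p (star a) := by
        rw [star_star]; exact p.mul_le' _ _
      rw [e] at f
      have : 0 ≤ p (star a) := apply_nonneg _ _
      rcases this.eq_or_lt with h | h
      · rw [← h]; exact apply_nonneg _ _
      · exact le_of_mul_le_mul_right f h
    calc p (star a) * p (T (T.adjLin a)) ≤ p a * (c * n) :=
          mul_le_mul h3 h2 (apply_nonneg _ _) (apply_nonneg _ _)
      _ = _ := by ring
  have h0 : 0 ≤ n := modNorm_nonneg p _
  rcases h0.eq_or_lt with h | h
  · rw [← h]; exact mul_nonneg hc0 (apply_nonneg _ _)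
  · rw [sq] at h1; exact le_of_mul_le_mul_right h1 h

/-- `K_A(E, A)` as a complex vector space. -/
def compactsSubmodule (A E : Type*) [LocallyCStarAlgebra A] [AddCommGroup E] [Module ℂ E]
    [HilbertModule A E] : Submodule ℂ (Adj A E A) where
  carrier := compacts A E A
  zero_mem' := fun p ε hε => ⟨0, zero_mem _, fun x => by
    simpa [modNorm_alg] using mul_nonneg hε.le (modNorm_nonneg p x)⟩
  add_mem' := by
    have key : ∀ (p : CStarSeminorm A) (S T : Adj A E A) (c d : ℝ), S.OpBound p c →
        T.OpBound p d → (S + T).OpBound p (c + d) := by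
      intro p S T c d hS hT x
      have h1 := hS x
      have h2 := hT x
      rw [modNorm_alg] at h1 h2 ⊢
      rw [add_mul]
      exact (map_add_le_add p.toSeminorm _ _).trans (add_le_add h1 h2)
    intro S T hS hT p ε hε
    obtain ⟨R, hR, h1⟩ := hS p (ε / 2) (by positivity)
    obtain ⟨Q, hQ, h2⟩ := hT p (ε / 2) (by positivity)
    refine ⟨R + Q, add_mem hR hQ, ?_⟩
    have := key p _ _ _ _ h1 h2
    rwa [add_halves, sub_add_sub_comm] at this
  smul_mem' := by
    have key : ∀ (p : CStarSeminorm A) (z : ℂ) (T : Adj A E A) (d : ℝ),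
        T.OpBound p d → (z • T).OpBound p (‖z‖ * d) := by
      intro p z T d hT x
      have h2 := hT x
      rw [modNorm_alg] at h2 ⊢
      rw [mul_assoc, Adj.smul_apply, map_smul_eq_mul]
      exact mul_le_mul_of_nonneg_left h2 (norm_nonneg _)
    intro z T hT p ε hε
    obtain ⟨Q, hQ, h2⟩ := hT p (ε / (‖z‖ + 1)) (by positivity)
    refine ⟨z • Q, Submodule.smul_mem _ _ hQ, ?_⟩
    have h3 := key p z _ _ h2
    rw [smul_sub] at h3
    refine fun x => (h3 x).trans (mul_le_mul_of_nonneg_right ?_ (modNorm_nonneg p x))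
    rw [mul_div_assoc', div_le_iff₀ (by positivity)]
    nlinarith [norm_nonneg z]

theorem compacts_comp {T : Adj A E A} (hT : T ∈ compacts A E A) {S : Adj A E E}
    (hS : S ∈ compacts A E E) : T.comp S ∈ compacts A E A := by
  intro p ε hε
  obtain ⟨R, hR, h1⟩ := hT p ε hε
  obtain ⟨Q, hQ, h2⟩ := hS p 1 one_pos
  refine ⟨R.comp S + (T - R).comp Q,
    add_mem (finiteRank_comp S hR) (comp_finiteRank (T - R) hQ), ?_⟩
  have e : T.comp S - (R.comp S + (T - R).comp Q) = (T - R).comp (S - Q) := by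
    simp only [sub_eq_add_neg]; ext <;> simp <;> abel
  rw [e, ← mul_one ε]
  exact comp_opBound hε.le h1 h2

theorem adjoint_comp_compacts {S T : Adj A E A} (hS : S ∈ compacts A E A)
    (hT : T ∈ compacts A E A) : S.adjoint.comp T ∈ compacts A E E := by
  intro p ε hε
  obtain ⟨R, hR, h1⟩ := hS p ε hε
  obtain ⟨Q, hQ, h2⟩ := hT p 1 one_pos
  refine ⟨S.adjoint.comp Q + R.adjoint.comp (T - Q),
    add_mem (comp_finiteRank _ hQ) (finiteRank_comp _ (adjoint_finiteRank hR)), ?_⟩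
  have e : S.adjoint.comp T - (S.adjoint.comp Q + R.adjoint.comp (T - Q)) =
      (S - R).adjoint.comp (T - Q) := by
    simp only [sub_eq_add_neg]; ext <;> simp <;> abel
  rw [e, ← mul_one ε]
  exact comp_opBound hε.le (adjoint_opBound hε.le h1) h2

/-- Left multiplication by `a` as an adjointable operator on `A`. -/
def lmul (a : A) : Adj A A A where
  toLin := LinearMap.mulLeft ℂ a
  adjLin := LinearMap.mulLeft ℂ (star a)
  toLin_ract' x b := by simp [ract_alg, mul_assoc]
  adjLin_ract' x b := by simp [ract_alg, mul_assoc]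
  ip_toLin' x y := by simp [ip_self_alg, mul_assoc]

@[simp] theorem lmul_apply (a b : A) : lmul a b = a * b := rfl
@[simp] theorem lmul_adjLin (a b : A) : (lmul a).adjLin b = star a * b := rfl

theorem lmul_comp_compacts (a : A) {T : Adj A E A} (hT : T ∈ compacts A E A) :
    (lmul a).comp T ∈ compacts A E A := by
  intro p ε hε
  have hp : 0 ≤ p a := apply_nonneg _ _
  obtain ⟨R, hR, h⟩ := hT p (ε / (p a + 1)) (by positivity)
  refine ⟨(lmul a).comp R, comp_finiteRank _ hR, ?_⟩
  have hl : (lmul a).OpBound p (p a) := fun b => by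
    rw [modNorm_alg, modNorm_alg]; exact p.mul_le' a b
  have h1 := comp_opBound hp hl h
  have e : (lmul a).comp T - (lmul a).comp R = (lmul a).comp (T - R) := by
    simp only [sub_eq_add_neg]; ext <;> simp [mul_add]
  rw [e]
  refine fun x => (h1 x).trans (mul_le_mul_of_nonneg_right ?_ (modNorm_nonneg p x))
  rw [mul_div_assoc', div_le_iff₀ (by positivity)]
  nlinarith

variable {ι : B →⋆ₙₐ[ℂ] Adj A E E}

set_option linter.unusedVariables false in
/-- `Ẽ = K_A(E, A)`, regarded as a `B`-module through an isomorphism `ι : B → K_A(E)`. -/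
@[nolint unusedArguments]
def Tilde (hι : IsCompactIso ι) : Type _ := compactsSubmodule A E

namespace Tilde

variable (hι : IsCompactIso ι)

instance : AddCommGroup (Tilde hι) := inferInstanceAs (AddCommGroup (compactsSubmodule A E))
instance : Module ℂ (Tilde hι) := inferInstanceAs (Module ℂ (compactsSubmodule A E))

variable {hι}

/-- The underlying operator `E → A`. -/
def op (T : Tilde hι) : Adj A E A := Subtype.val (p := (· ∈ compactsSubmodule A E)) T

theorem op_mem (T : Tilde hι) : T.op ∈ compacts A E A :=
  Subtype.property (p := (· ∈ compactsSubmodule A E)) T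

theorem op_injective : Function.Injective (op (hι := hι)) := Subtype.val_injective

@[simp] theorem op_zero : (0 : Tilde hι).op = 0 := rfl
@[simp] theorem op_add (S T : Tilde hι) : (S + T).op = S.op + T.op := rfl
@[simp] theorem op_smul (c : ℂ) (T : Tilde hι) : (c • T).op = c • T.op := rfl

variable (hι) in
/-- The element of `Ẽ` given by a compact operator. -/
def mk (T : Adj A E A) (hT : T ∈ compacts A E A) : Tilde hι :=
  (⟨T, hT⟩ : compactsSubmodule A E)

@[simp] theorem op_mk (T : Adj A E A) (hT : T ∈ compacts A E A) : (mk hι T hT).op = T := rfl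

theorem iso_mem (hι : IsCompactIso ι) (b : B) : ι b ∈ compacts A E E :=
  hι.range_eq ▸ Set.mem_range_self b

theorem exists_ip (S T : Tilde hι) : ∃ b : B, ι b = S.op.adjoint.comp T.op := by
  have := adjoint_comp_compacts S.op_mem T.op_mem
  rwa [← hι.range_eq] at this

/-- The `B`-valued inner product `⟨S, T⟩ = ι⁻¹(S* T)` of `Ẽ`. -/
noncomputable def tip (S T : Tilde hι) : B := (exists_ip S T).choose

theorem iso_tip (S T : Tilde hι) : ι (tip S T) = S.op.adjoint.comp T.op :=
  (exists_ip S T).choose_spec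

/-- The `B`-module structure `(T, b) ↦ T ι(b)` of `Ẽ` and its inner product
`⟨S, T⟩ = ι⁻¹(S* T)`. -/
noncomputable instance : InnerModule B (Tilde hι) where
  ract := LinearMap.mk₂ ℂ (fun (T : Tilde hι) (b : B) =>
      mk hι (T.op.comp (ι b)) (compacts_comp T.op_mem (iso_mem hι b)))
    (fun S T b => op_injective (by ext <;> simp))
    (fun c T b => op_injective (by ext <;> simp))
    (fun T b c => op_injective (by ext <;> simp))
    (fun c T b => op_injective (by ext <;> simp))
  ip := LinearMap.mk₂'ₛₗ (starRingEnd ℂ) (RingHom.id ℂ) (tip (hι := hι))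
    (fun S T U => hι.injective (by rw [map_add]; simp only [iso_tip]; ext <;> simp))
    (fun c S T => hι.injective (by rw [map_smul]; simp only [iso_tip]; ext <;> simp))
    (fun S T U => hι.injective (by rw [map_add]; simp only [iso_tip]; ext <;> simp))
    (fun c S T => hι.injective (by
      rw [RingHom.id_apply, map_smul]; simp only [iso_tip]; ext <;> simp))
  ract_mul T a b := op_injective (by ext <;> simp)
  ip_ract S T b := hι.injective (by
    simp only [LinearMap.mk₂'ₛₗ_apply, LinearMap.mk₂_apply, map_mul, iso_tip]; ext <;> simp)
  star_ip S T := hι.injective (by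
    simp only [LinearMap.mk₂'ₛₗ_apply, map_star, iso_tip]; ext <;> simp)

theorem iso_ip (S T : Tilde hι) : ι (ip B S T) = S.op.adjoint.comp T.op := iso_tip S T

@[simp] theorem op_ract (T : Tilde hι) (b : B) : (ract T b).op = T.op.comp (ι b) := rfl

variable (hι) in
/-- The map `α(a) : T ↦ a T` on `Ẽ`, with adjoint `α(a*)`; it sends `θ_{b, x}` to `θ_{ab, x}`. -/
def leftMul (a : A) : Adj B (Tilde hι) (Tilde hι) where
  toLin :=
    { toFun := fun T => mk hι ((lmul a).comp T.op) (lmul_comp_compacts a T.op_mem)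
      map_add' := fun S T => op_injective (by ext <;> simp [mul_add])
      map_smul' := fun c T => op_injective (by ext <;> simp) }
  adjLin :=
    { toFun := fun T => mk hι ((lmul (star a)).comp T.op)
        (lmul_comp_compacts (star a) T.op_mem)
      map_add' := fun S T => op_injective (by ext <;> simp [mul_add])
      map_smul' := fun c T => op_injective (by ext <;> simp) }
  toLin_ract' T b := op_injective (by ext <;> simp)
  adjLin_ract' T b := op_injective (by ext <;> simp)
  ip_toLin' S T := hι.injective (by
    simp only [iso_ip]; ext <;> simp)

@[simp] theorem op_leftMul (a : A) (T : Tilde hι) : (leftMul hι a T).op = (lmul a).comp T.op := rfl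
@[simp] theorem op_leftMul_adjLin (a : A) (T : Tilde hι) :
    ((leftMul hι a).adjLin T).op = (lmul (star a)).comp T.op := rfl

variable (hι) in
/-- The left action `α : A → L_B(Ẽ)`, `α(a) T = a T`. -/
def leftAction : A →⋆ₙₐ[ℂ] Adj B (Tilde hι) (Tilde hι) where
  toFun := leftMul hι
  map_smul' c a := by
    ext T <;> refine op_injective ?_ <;> ext <;> simp [smul_mul_assoc]
  map_zero' := by
    ext T <;> refine op_injective ?_ <;> ext <;> simp
  map_add' a b := by
    ext T <;> refine op_injective ?_ <;> ext <;> simp [add_mul]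
  map_mul' a b := by
    ext T <;> refine op_injective ?_ <;> ext <;> simp [mul_assoc]
  map_star' a := by
    ext T <;> refine op_injective ?_ <;> ext <;> simp

@[simp] theorem op_leftAction (a : A) (T : Tilde hι) :
    (leftAction hι a T).op = (lmul a).comp T.op := rfl

end Tilde

/-! ### Induction along `Ẽ` -/

section TildeInduction

variable {H : Type*} [NormedAddCommGroup H] [InnerProductSpace ℂ H] [CompleteSpace H]
  {φ : A →⋆ₙₐ[ℂ] (H →L[ℂ] H)} {hpos : PositiveOn E φ} {hι : IsCompactIso ι}

/-- The map `x ⊗ h ↦ φ(T x) h` from the algebraic tensor product to `H`. -/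
noncomputable def evalOp (hpos : PositiveOn E φ) (T : Adj A E A) : PreInd E φ hpos →ₗ[ℂ] H :=
  (TensorProduct.lift (LinearMap.mk₂ ℂ (fun (x : E) (h : H) => φ (T x) h)
    (by intros; simp) (by intros; simp) (by intros; simp) (by intros; simp)) :
      E ⊗[ℂ] H →ₗ[ℂ] H)

theorem evalOp_ptmul (T : Adj A E A) (x : E) (h : H) :
    evalOp hpos T (ptmul hpos x h) = φ (T x) h := rfl

theorem evalOp_lmul (a : A) (T : Adj A E A) (t : PreInd E φ hpos) :
    evalOp hpos ((lmul a).comp T) t = φ a (evalOp hpos T t) := by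
  induction t using PreInd.induction with
  | h0 => simp
  | hadd s t hs ht => simp only [map_add, hs, ht]
  | htmul x h => simp [evalOp_ptmul]

theorem inner_evalOp (S T : Adj A E A) (s t : PreInd E φ hpos) :
    ⟪s, preLeft hpos (S.adjoint.comp T) t⟫_ℂ = ⟪evalOp hpos S s, evalOp hpos T t⟫_ℂ := by
  induction s using PreInd.induction with
  | h0 => simp
  | hadd s₁ s₂ h₁ h₂ => simp only [map_add, inner_add_left, h₁, h₂]
  | htmul x h =>
    induction t using PreInd.induction with
    | h0 => simp
    | hadd t₁ t₂ h₁ h₂ => simp only [map_add, inner_add_right, h₁, h₂]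
    | htmul y k =>
      rw [preLeft_ptmul, evalOp_ptmul, evalOp_ptmul, inner_ptmul, Adj.comp_apply,
        Adj.adjoint_apply, ← Adj.ip_toLin, ip_self_alg, map_mul, mul_apply_eq_comp,
        inner_apply_star]

theorem re_inner_tilde_coe (hΨ : Dominated φ ι) (T : Tilde hι) (t : PreInd E φ hpos) :
    RCLike.re ⟪(t : Ind E φ hpos), leftRep hpos hΨ (ip B T T) (t : Ind E φ hpos)⟫_ℂ =
      ‖evalOp hpos T.op t‖ ^ 2 := by
  rw [leftRep_coe, UniformSpace.Completion.inner_coe, Tilde.iso_ip, inner_evalOp,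
    inner_self_eq_norm_sq]

/-- The form defining `Ẽ ⊗ (E ⊗_φ H)` is positive. -/
theorem tilde_positiveOn (hpos : PositiveOn E φ) (hΨ : Dominated φ ι) (hι : IsCompactIso ι) :
    PositiveOn (Tilde hι) (leftRep hpos hΨ) := by
  intro T t
  induction t using UniformSpace.Completion.induction_on with
  | hp =>
    exact isClosed_le continuous_const (RCLike.continuous_re.comp
      (continuous_id.inner (leftRep hpos hΨ (ip B T T)).continuous))
  | ih t => rw [re_inner_tilde_coe]; positivity

/-- The left action of `A` on `Ẽ` extends to `Ẽ ⊗ (E ⊗_φ H)`. -/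
theorem tilde_dominated (hpos : PositiveOn E φ) (hφ : Continuous φ) (hΨ : Dominated φ ι)
    (hι : IsCompactIso ι) : Dominated (leftRep hpos hΨ) (Tilde.leftAction hι) := by
  refine ⟨repSeminorm φ hφ, fun T t =>
    ⟨√(RCLike.re ⟪t, leftRep hpos hΨ (ip B T T) t⟫_ℂ), fun a => ?_⟩⟩
  rw [mul_pow, Real.sq_sqrt (tilde_positiveOn hpos hΨ hι T t)]
  induction t using UniformSpace.Completion.induction_on with
  | hp =>
    exact isClosed_le
      (RCLike.continuous_re.comp (continuous_id.inner (leftRep hpos hΨ _).continuous))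
      ((RCLike.continuous_re.comp
        (continuous_id.inner (leftRep hpos hΨ (ip B T T)).continuous)).mul continuous_const)
  | ih t =>
    rw [re_inner_tilde_coe, re_inner_tilde_coe, Tilde.op_leftAction, evalOp_lmul,
      repSeminorm_apply, ← mul_pow, mul_comm]
    exact pow_le_pow_left₀ (norm_nonneg _) ((φ a).le_opNorm _) 2

end TildeInduction

end Tilde

section DoubleInduction

variable {A B : Type*} [LocallyCStarAlgebra A] [LocallyCStarAlgebra B]
  {E : Type*} [AddCommGroup E] [Module ℂ E] [HilbertModule A E]
  {V : Type*} [AddCommGroup V] [Module ℂ V] [HilbertModule A V]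
  {H : Type*} [NormedAddCommGroup H] [InnerProductSpace ℂ H] [CompleteSpace H]
  {K : Type*} [NormedAddCommGroup K] [InnerProductSpace ℂ K] [CompleteSpace K]
  {ι : B →⋆ₙₐ[ℂ] Adj A E E}

/-- The representation of `W` induced from a representation `Φ` of `V` via a Hilbert `A`-module `E`
on which `B` acts through a continuous `*`-morphism `Ψ : B → L_A(E)`. -/
noncomputable abbrev ModuleRep.inducedRep (Φ : ModuleRep A V H K) (W : Type*) [AddCommGroup W]
    [Module ℂ W] [HilbertModule B W] {Ψ : B →⋆ₙₐ[ℂ] Adj A E E} (hΨ : IsContinuousAction Ψ) :=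
  Φ.induce W Ψ (HilbertModule.positiveOn E Φ.base) (dominated_of_continuous Φ.continuous_base hΨ)

theorem ModuleRep.tilde_positiveOn (Φ : ModuleRep A V H K) (W : Type*) [AddCommGroup W]
    [Module ℂ W] [HilbertModule B W] (hι : IsCompactIso ι) :
    PositiveOn (Tilde hι) (Φ.inducedRep W hι.continuous).base :=
  LocallyCStar.tilde_positiveOn (HilbertModule.positiveOn E Φ.base)
    (dominated_of_continuous Φ.continuous_base hι.continuous) hι

theorem ModuleRep.tilde_dominated (Φ : ModuleRep A V H K) (W : Type*) [AddCommGroup W]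
    [Module ℂ W] [HilbertModule B W] (hι : IsCompactIso ι) :
    Dominated (Φ.inducedRep W hι.continuous).base (Tilde.leftAction hι) :=
  LocallyCStar.tilde_dominated (HilbertModule.positiveOn E Φ.base) Φ.continuous_base
    (dominated_of_continuous Φ.continuous_base hι.continuous) hι

/-- The doubly induced representation: the representation of `W` induced from `Φ` via `E` and the
isomorphism `ι : B → K_A(E)`, induced back to `V` via the `B`-module `Ẽ = K_A(E, A)` and the left
action `α(a) T = a T` of `A` on `Ẽ`. -/
noncomputable abbrev ModuleRep.doublyInducedRep (Φ : ModuleRep A V H K) (W : Type*)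
    [AddCommGroup W] [Module ℂ W] [HilbertModule B W] (hι : IsCompactIso ι) :=
  (Φ.inducedRep W hι.continuous).induce V (Tilde.leftAction hι)
    (Φ.tilde_positiveOn W hι) (Φ.tilde_dominated W hι)

end DoubleInduction

end LocallyCStar

/-!
Write `φ` for the representation of `A` belonging to `Φ`.  The evaluation
`T ⊗ (x ⊗ h) ↦ φ(T x) h` maps `Ẽ ⊗ (E ⊗_φ H)` isometrically into `H`, because
`⟨φ(S x) h, φ(T y) k⟩ = ⟨x ⊗ h, (S* T) y ⊗ k⟩` and `S* T` is the operator by which `⟨S, T⟩ ∈ B` acts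
on `E ⊗_φ H` (`inner_evalOp`, `inner_tilde_ptmul`).  Its range contains the vectors
`φ(a) φ(⟨x, y⟩) h`, which come from the rank one operators `θ_{a, x}`; as `E` is full and `φ` is
non-degenerate, they are total in `H` (`dense_span_evalOp`).  The inverse of the evaluation is
therefore a unitary `U₁ : H → Ẽ ⊗ (E ⊗_φ H)`, and it intertwines `φ` with the left action of `A`
since evaluating at `a T` amounts to evaluating at `T` and applying `φ(a)` (`evalOp_lmul`).

A non-degenerate representation is determined by its base up to unitary equivalence: any unitary
`U₁` intertwining the bases of two representations with `Φ(V)H` and `Φ'(V)H'` total lifts to a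
unitary equivalence through `Φ(v) h ↦ Φ'(v) U₁ h`, because both sides have inner products given by
the bases, `⟨Φ(v) h, Φ(w) k⟩ = ⟨h, φ(⟨v, w⟩) k⟩`
(`ModuleRep.unitarilyEquivalent_of_base`).

Both unitaries come from one principle: two total families of vectors with the same Gram matrix are
related by a unitary (`exists_linearIsometryEquiv_of_inner_eq`).
-/

namespace LocallyCStar

/-! ### Total families of vectors -/

theorem map_mem_of_dense_span {M N : Type*} [AddCommGroup M] [Module ℂ M] [TopologicalSpace M]
    [AddCommGroup N] [Module ℂ N] [TopologicalSpace N] {s : Set M}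
    (hs : Dense (Submodule.span ℂ s : Set M)) (L : M →ₗ[ℂ] N) (hL : Continuous L)
    {P : Submodule ℂ N} (hP : IsClosed (P : Set N)) (h : ∀ x ∈ s, L x ∈ P) (x : M) : L x ∈ P := by
  have hle : Submodule.span ℂ s ≤ P.comap L := Submodule.span_le.mpr h
  exact closure_minimal (fun y hy => hle hy) (hP.preimage hL) (hs x)

theorem dense_span_of_dense_span {M : Type*} [NormedAddCommGroup M] [NormedSpace ℂ M]
    {s t : Set M} (hs : Dense (Submodule.span ℂ s : Set M))
    (h : ∀ x ∈ s, x ∈ (Submodule.span ℂ t).topologicalClosure) :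
    Dense (Submodule.span ℂ t : Set M) := fun x =>
  map_mem_of_dense_span hs LinearMap.id continuous_id
    (Submodule.isClosed_topologicalClosure (Submodule.span ℂ t)) h x

/-- Two total families of vectors with the same Gram matrix are related by a unitary. -/
theorem exists_linearIsometryEquiv_of_inner_eq {κ X Y : Type*}
    [NormedAddCommGroup X] [InnerProductSpace ℂ X] [CompleteSpace X]
    [NormedAddCommGroup Y] [InnerProductSpace ℂ Y] [CompleteSpace Y] (f : κ → X) (g : κ → Y)
    (hf : Dense (Submodule.span ℂ (Set.range f) : Set X))
    (hg : Dense (Submodule.span ℂ (Set.range g) : Set Y))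
    (hfg : ∀ i j, ⟪f i, f j⟫_ℂ = ⟪g i, g j⟫_ℂ) :
    ∃ U : X ≃ₗᵢ[ℂ] Y, ∀ i, U (f i) = g i := by
  have hf' : DenseRange (Finsupp.linearCombination ℂ f) := by
    rwa [DenseRange, ← LinearMap.coe_range, Finsupp.range_linearCombination]
  have hg' : DenseRange (Finsupp.linearCombination ℂ g) := by
    rwa [DenseRange, ← LinearMap.coe_range, Finsupp.range_linearCombination]
  have hnorm : ∀ c : κ →₀ ℂ, ‖Finsupp.linearCombination ℂ g (LinearEquiv.refl ℂ _ c)‖ =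
      ‖Finsupp.linearCombination ℂ f c‖ := by
    intro c
    rw [LinearEquiv.refl_apply, norm_eq_sqrt_re_inner (𝕜 := ℂ), norm_eq_sqrt_re_inner (𝕜 := ℂ)]
    simp only [Finsupp.linearCombination_apply, Finsupp.sum, sum_inner, inner_sum, inner_smul_left,
      inner_smul_right, hfg]
  refine ⟨(LinearEquiv.refl ℂ (κ →₀ ℂ)).extendOfIsometry _ _ hf' hg' hnorm, fun i => ?_⟩
  simpa using LinearEquiv.extendOfIsometry_eq _ _ _ hf' hg' hnorm (Finsupp.single i 1)

/-! ### Representations and their bases -/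

section Base

variable {A : Type*} [LocallyCStarAlgebra A]
  {V : Type*} [AddCommGroup V] [Module ℂ V]
  {H : Type*} [NormedAddCommGroup H] [InnerProductSpace ℂ H] [CompleteSpace H]
  {K : Type*} [NormedAddCommGroup K] [InnerProductSpace ℂ K] [CompleteSpace K]
  {H' : Type*} [NormedAddCommGroup H'] [InnerProductSpace ℂ H'] [CompleteSpace H']
  {K' : Type*} [NormedAddCommGroup K'] [InnerProductSpace ℂ K'] [CompleteSpace K']

theorem ModuleRep.inner_toFun [InnerModule A V] (Φ : ModuleRep A V H K) (v w : V) (h k : H) :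
    ⟪Φ.toFun v h, Φ.toFun w k⟫_ℂ = ⟪h, Φ.base (ip A v w) k⟫_ℂ := by
  rw [← Φ.adjoint_comp, ContinuousLinearMap.comp_apply, ContinuousLinearMap.adjoint_inner_right]

/-- The base of a non-degenerate representation is non-degenerate: the vectors
`Φ(v)* Φ(w) h = φ(⟨v, w⟩) h` are total. -/
theorem ModuleRep.Nondegenerate.dense_span_base [InnerModule A V] {Φ : ModuleRep A V H K}
    (hΦ : Φ.Nondegenerate) :
    Dense (Submodule.span ℂ {k : H | ∃ a h, k = Φ.base a h} : Set H) := by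
  refine dense_span_of_dense_span hΦ.2 ?_
  rintro _ ⟨v, k, rfl⟩
  refine map_mem_of_dense_span hΦ.1 (ContinuousLinearMap.adjoint (Φ.toFun v)).toLinearMap
    (ContinuousLinearMap.adjoint (Φ.toFun v)).continuous
    (Submodule.isClosed_topologicalClosure _) ?_ k
  rintro _ ⟨w, h, rfl⟩
  refine Submodule.le_topologicalClosure _ (Submodule.subset_span ⟨ip A v w, h, ?_⟩)
  rw [← Φ.adjoint_comp]
  rfl

/-- A unitary intertwining the bases of two representations of `V` extends to a unitary
equivalence, provided that `Φ(V)H` and `Φ'(V)H'` are total. -/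
theorem ModuleRep.unitarilyEquivalent_of_base [InnerModule A V] (Φ : ModuleRep A V H K)
    (Φ' : ModuleRep A V H' K')
    (hΦ : Dense (Submodule.span ℂ {k : K | ∃ v h, k = Φ.toFun v h} : Set K))
    (hΦ' : Dense (Submodule.span ℂ {k : K' | ∃ v h, k = Φ'.toFun v h} : Set K'))
    (U : H ≃ₗᵢ[ℂ] H') (hU : ∀ a h, U (Φ.base a h) = Φ'.base a (U h)) :
    Φ.UnitarilyEquivalent Φ' := by
  obtain ⟨U₂, hU₂⟩ := exists_linearIsometryEquiv_of_inner_eq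
    (fun i : V × H => Φ.toFun i.1 i.2) (fun i : V × H => Φ'.toFun i.1 (U i.2))
    (by
      convert hΦ using 3
      ext k
      simp [eq_comm])
    (by
      convert hΦ' using 3
      ext k
      constructor
      · rintro ⟨i, rfl⟩
        exact ⟨i.1, U i.2, rfl⟩
      · rintro ⟨v, h, rfl⟩
        exact ⟨(v, U.symm h), by simp⟩)
    (fun i j => by
      rw [Φ.inner_toFun, Φ'.inner_toFun, ← hU, LinearIsometryEquiv.inner_map_map])
  exact ⟨U, U₂, fun v h => hU₂ (v, h)⟩

/-- The elementary tensors are total in `V ⊗_ψ H`. -/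
theorem dense_span_ptmul [InnerModule A V] {ψ : A →⋆ₙₐ[ℂ] (H →L[ℂ] H)} (hpos : PositiveOn V ψ) :
    Dense (Submodule.span ℂ {k : Ind V ψ hpos | ∃ v h, k = tmulL hpos v h} :
      Set (Ind V ψ hpos)) := by
  refine UniformSpace.Completion.denseRange_coe.mono ?_
  rintro _ ⟨t, rfl⟩
  induction t using PreInd.induction with
  | h0 => rw [UniformSpace.Completion.coe_zero]; exact zero_mem _
  | htmul v h => exact Submodule.subset_span ⟨v, h, rfl⟩
  | hadd s t hs ht => rw [UniformSpace.Completion.coe_add]; exact add_mem hs ht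

end Base

/-! ### The evaluation `Ẽ ⊗ (E ⊗_φ H) → H` -/

section Evaluation

variable {A B : Type*} [LocallyCStarAlgebra A] [LocallyCStarAlgebra B]
  {E : Type*} [AddCommGroup E] [Module ℂ E] [HilbertModule A E]
  {H : Type*} [NormedAddCommGroup H] [InnerProductSpace ℂ H] [CompleteSpace H]
  {φ : A →⋆ₙₐ[ℂ] (H →L[ℂ] H)} {ι : B →⋆ₙₐ[ℂ] Adj A E E}

theorem inner_tilde_ptmul {hpos : PositiveOn E φ} (hΨ : Dominated φ ι) (hι : IsCompactIso ι)
    (hpos' : PositiveOn (Tilde hι) (leftRep hpos hΨ)) (S T : Tilde hι) (s t : PreInd E φ hpos) :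
    ⟪tmulL hpos' S (s : Ind E φ hpos), tmulL hpos' T (t : Ind E φ hpos)⟫_ℂ =
      ⟪evalOp hpos S.op s, evalOp hpos T.op t⟫_ℂ := by
  rw [tmulL_apply, tmulL_apply, UniformSpace.Completion.inner_coe, inner_ptmul, leftRep_coe,
    UniformSpace.Completion.inner_coe, Tilde.iso_ip, inner_evalOp]

/-- The evaluation has dense range: the rank one operators `θ_{a, x}` contribute the vectors
`φ(a) φ(⟨x, y⟩) h`. -/
theorem dense_span_evalOp (hpos : PositiveOn E φ) (hφ : Continuous φ) (hE : IsFull A E)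
    (hnd : Dense (Submodule.span ℂ {k : H | ∃ a h, k = φ a h} : Set H)) (hι : IsCompactIso ι) :
    Dense (Submodule.span ℂ (Set.range fun i : Tilde hι × PreInd E φ hpos =>
      evalOp hpos i.1.op i.2) : Set H) := by
  refine dense_span_of_dense_span hnd ?_
  rintro _ ⟨a, k, rfl⟩
  refine map_mem_of_dense_span hnd (φ a).toLinearMap (φ a).continuous
    (Submodule.isClosed_topologicalClosure _) ?_ k
  rintro _ ⟨b, h, rfl⟩
  refine map_mem_of_dense_span hE
    ((φ a).toLinearMap ∘ₗ (ContinuousLinearMap.apply ℂ H h).toLinearMap ∘ₗ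
      (φ : A →ₗ[ℂ] (H →L[ℂ] H)))
    ((φ a).continuous.comp ((ContinuousLinearMap.apply ℂ H h).continuous.comp hφ))
    (Submodule.isClosed_topologicalClosure _) ?_ b
  rintro _ ⟨x, y, rfl⟩
  refine Submodule.le_topologicalClosure _ (Submodule.subset_span
    ⟨(Tilde.mk hι (Adj.theta a x) (fun p ε hε => ?_), ptmul hpos y h), ?_⟩)
  · refine ⟨Adj.theta a x, Submodule.subset_span ⟨a, x, rfl⟩, fun z => ?_⟩
    rw [Adj.sub_apply, sub_self, modNorm_alg, map_zero]
    exact mul_nonneg hε.le (modNorm_nonneg p z)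
  · change evalOp hpos (Adj.theta a x) (ptmul hpos y h) = φ a (φ (ip A x y) h)
    rw [evalOp_ptmul, Adj.theta_apply, ract_alg, map_mul, mul_apply_eq_comp]

theorem dense_span_tilde_ptmul {hpos : PositiveOn E φ} (hΨ : Dominated φ ι) (hι : IsCompactIso ι)
    (hpos' : PositiveOn (Tilde hι) (leftRep hpos hΨ)) :
    Dense (Submodule.span ℂ (Set.range fun i : Tilde hι × PreInd E φ hpos =>
      tmulL hpos' i.1 (i.2 : Ind E φ hpos)) : Set (Ind (Tilde hι) (leftRep hpos hΨ) hpos')) := by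
  refine dense_span_of_dense_span (dense_span_ptmul hpos') ?_
  rintro _ ⟨T, x, rfl⟩
  induction x using UniformSpace.Completion.induction_on with
  | hp => exact (Submodule.isClosed_topologicalClosure _).preimage (tmulL hpos' T).continuous
  | ih t => exact Submodule.le_topologicalClosure _ (Submodule.subset_span ⟨(T, t), rfl⟩)

/-- The inverse of the evaluation `T ⊗ (x ⊗ h) ↦ φ(T x) h`, a unitary from `H` to
`Ẽ ⊗ (E ⊗_φ H)` intertwining `φ` with the left action of `A`. -/
theorem exists_unitary_tilde {hpos : PositiveOn E φ} (hφ : Continuous φ) (hE : IsFull A E)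
    (hnd : Dense (Submodule.span ℂ {k : H | ∃ a h, k = φ a h} : Set H)) (hΨ : Dominated φ ι)
    (hι : IsCompactIso ι) (hpos' : PositiveOn (Tilde hι) (leftRep hpos hΨ))
    (hdom : Dominated (leftRep hpos hΨ) (Tilde.leftAction hι)) :
    ∃ U : H ≃ₗᵢ[ℂ] Ind (Tilde hι) (leftRep hpos hΨ) hpos', ∀ (a : A) (h : H),
      U (φ a h) = leftRep hpos' hdom a (U h) := by
  have hdense := dense_span_evalOp hpos hφ hE hnd hι
  obtain ⟨U, hU⟩ := exists_linearIsometryEquiv_of_inner_eq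
    (fun i : Tilde hι × PreInd E φ hpos => evalOp hpos i.1.op i.2)
    (fun i : Tilde hι × PreInd E φ hpos => tmulL hpos' i.1 (i.2 : Ind E φ hpos))
    hdense (dense_span_tilde_ptmul hΨ hι hpos')
    (fun i j => (inner_tilde_ptmul hΨ hι hpos' i.1 j.1 i.2 j.2).symm)
  refine ⟨U, fun a h => ?_⟩
  have heq : (U : H →L[ℂ] _).comp (φ a) = (leftRep hpos' hdom a).comp (U : H →L[ℂ] _) := by
    refine ContinuousLinearMap.ext_on hdense ?_
    rintro _ ⟨⟨T, t⟩, rfl⟩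
    change U (φ a (evalOp hpos T.op t)) = leftRep hpos' hdom a (U (evalOp hpos T.op t))
    rw [hU (T, t), tmulL_apply, leftRep_ptmul, ← evalOp_lmul, ← Tilde.op_leftAction,
      hU (Tilde.leftAction hι a T, t), tmulL_apply]
  exact DFunLike.congr_fun heq h

end Evaluation

end LocallyCStar

theorem theorem4p4 {A B : Type*} [LocallyCStar.LocallyCStarAlgebra A]
    [LocallyCStar.LocallyCStarAlgebra B]
    {V : Type*} [AddCommGroup V] [Module ℂ V] [LocallyCStar.HilbertModule A V]
    {W : Type*} [AddCommGroup W] [Module ℂ W] [LocallyCStar.HilbertModule B W]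
    (hV : LocallyCStar.IsFull A V) (hW : LocallyCStar.IsFull B W)
    (hVW : LocallyCStar.MoritaEquivalent A B V W)
    {E : Type*} [AddCommGroup E] [Module ℂ E] [LocallyCStar.HilbertModule A E]
    (hE : LocallyCStar.IsFull A E)
    (ι : B →⋆ₙₐ[ℂ] LocallyCStar.Adj A E E) (hι : LocallyCStar.IsCompactIso ι)
    {H : Type*} [NormedAddCommGroup H] [InnerProductSpace ℂ H] [CompleteSpace H]
    {K : Type*} [NormedAddCommGroup K] [InnerProductSpace ℂ K] [CompleteSpace K]
    (Φ : LocallyCStar.ModuleRep A V H K) (hΦ : Φ.Nondegenerate) :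
    Φ.UnitarilyEquivalent (Φ.doublyInducedRep W hι) := by
  obtain ⟨U, hU⟩ := LocallyCStar.exists_unitary_tilde Φ.continuous_base hE hΦ.dense_span_base
    (LocallyCStar.dominated_of_continuous Φ.continuous_base hι.continuous) hι
    (Φ.tilde_positiveOn W hι) (Φ.tilde_dominated W hι)
  exact Φ.unitarilyEquivalent_of_base (Φ.doublyInducedRep W hι) hΦ.1
    (LocallyCStar.dense_span_ptmul _) U hU
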